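/- Let $\mathcal H$ be a complex Hilbert space, $\mathcal H^{(n)}=\mathcal H\otimes\cdots\otimes\mathcal H$ the Hilbert space tensor product of $n$ copies of $\mathcal H$ ($\mathcal H^{(0)}=\mathbb C$), and $\mathcal F(\mathcal H)=\bigoplus_{n\ge 0}\mathcal H^{(n)}$ the Fock space (Hilbert space direct sum). For a self-adjoint, possibly unbounded operator $A$ on $\mathcal H$ with domain $\mathcal D(A)$, let the second quantization $d\Gamma(A)$ be the closure of the operator on $\mathcal F(\mathcal H)$ defined on the vectors with finitely many non-zero components, the $n$-th of them in the algebraic tensor power $\bigotimes_{j=1}^n\mathcal D(A)$, that acts on $\mathcal H^{(n)}$ as $\sum_{j=1}^n 1\otimes\cdots\otimes A\otimes\cdots\otimes 1$ ($A$ in the $j$-th place; for $n=0$ it is $0$). For a closed operator $T$, let $\operatorname{spec}(T)$ be the set of $z\in\mathbb C$ such that $T-z$ is not a bijection from $\mathcal D(T)$ onto the whole space, and let the continuous spectrum $\operatorname{spec}_c(T)$ be the set of $z\in\mathbb C$ such that $T-z$ is injective with dense range but not surjective. Let $A$ be self-adjoint. 1. Suppose that $A$ has a discrete spectral resolution: $A\varphi_j=\lambda_j\varphi_j$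 with $\lambda_j\in\mathbb R$ for an orthonormal basis $(\varphi_j)_{j\in J}$ of $\mathcal H$. Then, for every $n\ge 0$, $d\Gamma(A)|_{\mathcal H^{(n)}}$ has a discrete spectral resolution: the vectors $\varphi_{i_1}\otimes\cdots\otimes\varphi_{i_n}$ ($i_1,\dots,i_n\in J$) form an orthonormal basis of $\mathcal H^{(n)}$, lie in the domain of $d\Gamma(A)|_{\mathcal H^{(n)}}$, and $$d\Gamma(A)|_{\mathcal H^{(n)}}\,\varphi_{i_1}\otimes\cdots\otimes\varphi_{i_n}=\Big(\sum_{j=1}^n\lambda_{i_j}\Big)\,\varphi_{i_1}\otimes\cdots\otimes\varphi_{i_n}.$$ 2. Suppose that $A$ has purely continuous spectrum, $\operatorname{spec}(A)=\operatorname{spec}_c(A)$. Then, for every $n\ge 1$, $d\Gamma(A)|_{\mathcal H^{(n)}}$ has purely continuous spectrum, and $$\operatorname{spec}\big(d\Gamma(A)|_{\mathcal H^{(n)}}\big)=\operatorname{spec}_c\big(d\Gamma(A)|_{\mathcal H^{(n)}}\big)=\overline{\Big\{\sum_{j=1}^n\lambda_j\;\Big|\;\lambda_j\in\operatorname{spec}_c(A)\text{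 for }1\le j\le n\Big\}}.$$ If moreover $\operatorname{spec}_c(A)$ is bounded from below or from above, then the closure can be omitted: $$\operatorname{spec}_c\big(d\Gamma(A)|_{\mathcal H^{(n)}}\big)=\Big\{\sum_{j=1}^n\lambda_j\;\Big|\;\lambda_j\in\operatorname{spec}_c(A)\text{ for }1\le j\le n\Big\}.$$ -/

import Mathlib

open scoped TensorProduct ComplexConjugate

noncomputable section

namespace SecondQuantization

/-! ### The Hilbert space tensor power -/

section TensorPower

/-- The algebraic `n`-fold tensor power of `H` (a copy of Mathlib's `⨂[ℂ] _ : Fin n, H`,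
which carries another norm). -/
def AlgTensor (H : Type*) [NormedAddCommGroup H] [InnerProductSpace ℂ H] (n : ℕ) : Type _ :=
  ⨂[ℂ] _ : Fin n, H

variable {H : Type*} [NormedAddCommGroup H] [InnerProductSpace ℂ H] {n : ℕ}

instance algTensorAddCommMonoid : AddCommMonoid (AlgTensor H n) :=
  inferInstanceAs (AddCommMonoid (⨂[ℂ] _ : Fin n, H))

instance algTensorModule : Module ℂ (AlgTensor H n) :=
  inferInstanceAs (Module ℂ (⨂[ℂ] _ : Fin n, H))

instance algTensorAddCommGroup : AddCommGroup (AlgTensor H n) :=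
  Module.addCommMonoidToAddCommGroup ℂ

/-- The elementary tensor `x₁ ⊗ … ⊗ xₙ` in the algebraic tensor power. -/
def algTprod : MultilinearMap ℂ (fun _ : Fin n => H) (AlgTensor H n) :=
  PiTensorProduct.tprod ℂ

/-- The functional `x₁ ⊗ … ⊗ xₙ ↦ ∏ ⟪yᵢ, xᵢ⟫`. -/
def algInnerLeft (y : Fin n → H) : AlgTensor H n →ₗ[ℂ] ℂ :=
  PiTensorProduct.lift
    ((MultilinearMap.mkPiAlgebra ℂ (Fin n) ℂ).compLinearMap fun i => innerₛₗ ℂ (y i))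

theorem algInnerLeft_tprod (y x : Fin n → H) :
    algInnerLeft y (algTprod x) = ∏ i, inner ℂ (y i) (x i) :=
  (PiTensorProduct.lift.tprod x).trans (by simp)

theorem algTensor_mem_span (t : AlgTensor H n) :
    t ∈ Submodule.span ℂ (Set.range fun x : Fin n → H => algTprod x) := by
  have h := PiTensorProduct.span_tprod_eq_top (R := ℂ) (s := fun _ : Fin n => H)
  have ht : (show ⨂[ℂ] _ : Fin n, H from t) ∈ (⊤ : Submodule ℂ (⨂[ℂ] _ : Fin n, H)) :=
    Submodule.mem_top
  rw [← h] at ht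
  exact ht

theorem algTensor_induction {p : AlgTensor H n → Prop} (t : AlgTensor H n)
    (h : ∀ x, p (algTprod x)) (h0 : p 0) (hadd : ∀ s t, p s → p t → p (s + t))
    (hsmul : ∀ (c : ℂ) s, p s → p (c • s)) : p t := by
  refine Submodule.span_induction (p := fun t _ => p t) ?_ h0 (fun s t _ _ => hadd s t)
    (fun c s _ => hsmul c s) (algTensor_mem_span t)
  rintro _ ⟨x, rfl⟩
  exact h x

theorem algTensor_hom_ext {M : Type*} [AddCommMonoid M] [Module ℂ M] {σ : ℂ →+* ℂ}
    {f g : AlgTensor H n →ₛₗ[σ] M} (h : ∀ x, f (algTprod x) = g (algTprod x)) : f = g := by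
  ext t
  induction t using algTensor_induction with
  | h x => exact h x
  | h0 => simp
  | hadd s t hs ht => simp [hs, ht]
  | hsmul c s hs => simp [hs]

/-- The sesquilinear form on the algebraic tensor power, linear in the first argument and
conjugate-linear in the second, with
`algForm (y₁ ⊗ … ⊗ yₙ) (x₁ ⊗ … ⊗ xₙ) = ∏ ⟪xᵢ, yᵢ⟫`. -/
def algForm : AlgTensor H n →ₗ[ℂ] (AlgTensor H n →ₛₗ[starRingEnd ℂ] ℂ) :=
  PiTensorProduct.lift
    { toFun := fun y =>
        ((starLinearEquiv ℂ : ℂ ≃ₗ⋆[ℂ] ℂ) : ℂ →ₛₗ[starRingEnd ℂ] ℂ).comp (algInnerLeft y)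
      map_update_add' := by
        intro d y i a b
        obtain rfl : d = instDecidableEqFin n := Subsingleton.elim _ _
        refine algTensor_hom_ext fun x => ?_
        have h : ∀ c : H, (∏ j, inner ℂ (x j) (Function.update y i c j)) =
            inner ℂ (x i) c * ∏ j ∈ Finset.univ.erase i, inner ℂ (x j) (y j) := by
          intro c
          rw [← Finset.mul_prod_erase _ _ (Finset.mem_univ i)]
          congr 1
          · simp
          · refine Finset.prod_congr rfl fun j hj => ?_
            rw [Function.update_of_ne (Finset.ne_of_mem_erase hj)]
        simp [algInnerLeft_tprod, h, add_mul]
      map_update_smul' := by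
        intro d y i c a
        obtain rfl : d = instDecidableEqFin n := Subsingleton.elim _ _
        refine algTensor_hom_ext fun x => ?_
        have h : ∀ c : H, (∏ j, inner ℂ (x j) (Function.update y i c j)) =
            inner ℂ (x i) c * ∏ j ∈ Finset.univ.erase i, inner ℂ (x j) (y j) := by
          intro c
          rw [← Finset.mul_prod_erase _ _ (Finset.mem_univ i)]
          congr 1
          · simp
          · refine Finset.prod_congr rfl fun j hj => ?_
            rw [Function.update_of_ne (Finset.ne_of_mem_erase hj)]
        simp [algInnerLeft_tprod, h, mul_assoc] }

theorem algForm_tprod (x y : Fin n → H) :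
    algForm (algTprod y) (algTprod x) = ∏ i, inner ℂ (x i) (y i) := by
  have h : algForm (algTprod y)
      = ((starLinearEquiv ℂ : ℂ ≃ₗ⋆[ℂ] ℂ) : ℂ →ₛₗ[starRingEnd ℂ] ℂ).comp (algInnerLeft y) :=
    PiTensorProduct.lift.tprod y
  simp [h, algInnerLeft_tprod]

open scoped ComplexOrder in
theorem posSemidef_prod_gram {𝕜 E : Type*} [RCLike 𝕜] [NormedAddCommGroup E]
    [InnerProductSpace 𝕜 E] {m n : ℕ} (x : Fin m → Fin n → E) :
    (Matrix.of fun k l => ∏ i, inner 𝕜 (x k i) (x l i)).PosSemidef := by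
  classical
  suffices h : ∀ s : Finset (Fin n),
      (Matrix.of fun k l => ∏ i ∈ s, inner 𝕜 (x k i) (x l i)).PosSemidef from h Finset.univ
  intro s
  induction s using Finset.induction_on with
  | empty =>
    have h : (Matrix.of fun k l => ∏ i ∈ (∅ : Finset (Fin n)), inner 𝕜 (x k i) (x l i))
        = Matrix.gram 𝕜 (fun _ : Fin m => (1 : 𝕜)) := by
      ext k l
      simp [Matrix.gram]
    rw [h]
    exact Matrix.posSemidef_gram 𝕜 _
  | insert i s hi ih =>
    have h : (Matrix.of fun k l => ∏ i ∈ insert i s, inner 𝕜 (x k i) (x l i))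
        = (Matrix.gram 𝕜 fun k => x k i).hadamard
          (Matrix.of fun k l => ∏ i ∈ s, inner 𝕜 (x k i) (x l i)) := by
      ext k l
      simp [Matrix.gram, Finset.prod_insert hi]
    rw [h]
    exact (Matrix.posSemidef_gram 𝕜 _).hadamard ih

/-- The inner product `⟪x₁ ⊗ … ⊗ xₙ, y₁ ⊗ … ⊗ yₙ⟫ = ∏ ⟪xᵢ, yᵢ⟫` on the algebraic tensor power. -/
@[reducible] def algCore (H : Type*) [NormedAddCommGroup H] [InnerProductSpace ℂ H] (n : ℕ) :
    PreInnerProductSpace.Core ℂ (AlgTensor H n) where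
  inner s t := algForm t s
  conj_inner_symm s t := by
    induction s using algTensor_induction with
    | h x =>
      induction t using algTensor_induction with
      | h y => simp [algForm_tprod]
      | h0 => simp
      | hadd s t hs ht => simp [hs, ht]
      | hsmul c s hs => simp [hs]
    | h0 => simp
    | hadd s t hs ht => simp [hs, ht]
    | hsmul c s hs => simp [hs]
  re_inner_nonneg t := by
    obtain ⟨m, c, x, rfl⟩ : ∃ (m : ℕ) (c : Fin m → ℂ) (x : Fin m → Fin n → H),
        t = ∑ k, c k • algTprod (x k) := by
      obtain ⟨m, c, g, h⟩ := Submodule.mem_span_set'.1 (algTensor_mem_span t)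
      choose x hx using fun k => (g k).2
      exact ⟨m, c, x, by simp only [hx, h]⟩
    have h := (posSemidef_prod_gram (𝕜 := ℂ) x).re_dotProduct_nonneg c
    convert h using 2
    simp only [map_sum, map_smul, LinearMap.sum_apply, LinearMap.smul_apply, map_smulₛₗ,
      algForm_tprod, dotProduct, Matrix.mulVec, smul_eq_mul, Matrix.of_apply, Pi.star_apply,
      Finset.mul_sum]
    refine Finset.sum_congr rfl fun k _ => Finset.sum_congr rfl fun l _ => ?_
    simp only [starRingEnd_apply]
    ring
  add_left s t u := by simp
  smul_left s t c := by simp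

instance : SeminormedAddCommGroup (AlgTensor H n) :=
  @InnerProductSpace.Core.toSeminormedAddCommGroup ℂ _ _ _ _ (algCore H n)

instance : InnerProductSpace ℂ (AlgTensor H n) :=
  InnerProductSpace.ofCore (algCore H n)

/-- The Hilbert space tensor power `H⁽ⁿ⁾ = H ⊗ ⋯ ⊗ H` (the `n`-particle space): the completion
of the algebraic tensor power. For `n = 0` it is one-dimensional, spanned by the empty tensor. -/
abbrev NParticle (H : Type*) [NormedAddCommGroup H] [InnerProductSpace ℂ H] (n : ℕ) : Type _ :=
  UniformSpace.Completion (AlgTensor H n)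

/-- The elementary tensor `x₁ ⊗ … ⊗ xₙ` in the `n`-particle space. -/
def tensor (x : Fin n → H) : NParticle H n :=
  ((algTprod x : AlgTensor H n) : UniformSpace.Completion (AlgTensor H n))

theorem inner_tensor (x y : Fin n → H) :
    inner ℂ (tensor x) (tensor y) = ∏ i, inner ℂ (x i) (y i) :=
  (UniformSpace.Completion.inner_coe _ _).trans (algForm_tprod x y)

end TensorPower

/-! ### Fock space and second quantization -/

section Fock

/-- The Fock space `⨁ₙ H⁽ⁿ⁾` (Hilbert space direct sum). -/
abbrev Fock (H : Type*) [NormedAddCommGroup H] [InnerProductSpace ℂ H] : Type _ :=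
  lp (fun n : ℕ => NParticle H n) 2

variable {H : Type*} [NormedAddCommGroup H] [InnerProductSpace ℂ H]

/-- The inclusion of the `n`-particle space in the Fock space. -/
abbrev incl (H : Type*) [NormedAddCommGroup H] [InnerProductSpace ℂ H] (n : ℕ) :
    NParticle H n →ₗ[ℂ] Fock H :=
  lp.lsingle 2 n

/-- `∑ⱼ x₁ ⊗ … ⊗ A xⱼ ⊗ … ⊗ xₙ` for `x₁, …, xₙ` in the domain of `A`. -/
def sumApply (A : H →ₗ.[ℂ] H) {n : ℕ} (x : Fin n → A.domain) : NParticle H n :=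
  ∑ j, tensor (Function.update (fun i => (x i : H)) j (A (x j)))

/-- The graph of `∑ⱼ 1 ⊗ … ⊗ A ⊗ … ⊗ 1`, taken in all the particle numbers, on the space of those
vectors of the Fock space that have finitely many non-zero components, the `n`-th of them in the
algebraic tensor power of the domain of `A`. -/
def preGraph (A : H →ₗ.[ℂ] H) : Submodule ℂ (Fock H × Fock H) :=
  Submodule.span ℂ
    {p | ∃ (n : ℕ) (x : Fin n → A.domain),
      p = (incl H n (tensor fun i => (x i : H)), incl H n (sumApply A x))}

/-- The second quantization `dΓ(A)`: the closure of `∑ⱼ 1 ⊗ … ⊗ A ⊗ … ⊗ 1`, that is, the operator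
whose graph is the closure of `preGraph A`
(see `graph_dGamma`: for a self-adjoint `A` this closure is a graph). -/
def dGamma (A : H →ₗ.[ℂ] H) : Fock H →ₗ.[ℂ] Fock H :=
  (preGraph A).topologicalClosure.toLinearPMap

/-- The restriction of an operator `T` on the Fock space to the `n`-particle space: its graph
consists of the pairs `(x, y)` of `n`-particle vectors with `x` in the domain of `T` and
`T x = y`. -/
def restrictTo (T : Fock H →ₗ.[ℂ] Fock H) (n : ℕ) : NParticle H n →ₗ.[ℂ] NParticle H n :=
  (T.graph.comap ((incl H n).prodMap (incl H n))).toLinearPMap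

theorem graph_restrictTo (T : Fock H →ₗ.[ℂ] Fock H) (n : ℕ) :
    (restrictTo T n).graph = T.graph.comap ((incl H n).prodMap (incl H n)) := by
  refine Submodule.toLinearPMap_graph_eq _ ?_
  rintro ⟨x, y⟩ h (rfl : x = 0)
  have h0 : incl H n y = 0 := T.graph_fst_eq_zero_snd (x := incl H n 0) h (map_zero _)
  have h1 := congrArg (fun f : Fock H => f n) h0
  simpa using h1

/-! The closure of `preGraph A` is a graph if `A` is self-adjoint. -/

theorem inner_incl (n : ℕ) (x : NParticle H n) (f : Fock H) :
    inner ℂ (incl H n x) f = inner ℂ x (f n) :=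
  lp.inner_single_left n x f

theorem inner_tensor_sumApply {A : H →ₗ.[ℂ] H} (hA : A.IsFormalAdjoint A) {n : ℕ}
    (x y : Fin n → A.domain) :
    inner ℂ (tensor fun i => (x i : H)) (sumApply A y) =
      inner ℂ (sumApply A x) (tensor fun i => (y i : H)) := by
  simp only [sumApply, inner_sum, sum_inner, inner_tensor]
  refine Finset.sum_congr rfl fun j _ => Finset.prod_congr rfl fun i _ => ?_
  rcases eq_or_ne i j with rfl | h
  · simp [hA (x i) (y i)]
  · simp [Function.update_of_ne h]

theorem inner_preGraph {A : H →ₗ.[ℂ] H} (hA : A.IsFormalAdjoint A) {p q : Fock H × Fock H}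
    (hp : p ∈ preGraph A) (hq : q ∈ preGraph A) : inner ℂ p.1 q.2 = inner ℂ p.2 q.1 := by
  induction hp using Submodule.span_induction with
  | mem p hp =>
    obtain ⟨n, x, rfl⟩ := hp
    induction hq using Submodule.span_induction with
    | mem q hq =>
      obtain ⟨m, y, rfl⟩ := hq
      simp only [inner_incl]
      rcases eq_or_ne n m with rfl | h
      · simpa using inner_tensor_sumApply hA x y
      · simp [h]
    | zero => simp
    | add _ _ _ _ h₁ h₂ => simp only [Prod.fst_add, Prod.snd_add, inner_add_right, h₁, h₂]
    | smul _ _ _ h => simp only [Prod.smul_fst, Prod.smul_snd, inner_smul_right, h]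
  | zero => simp
  | add _ _ _ _ h₁ h₂ => simp only [Prod.fst_add, Prod.snd_add, inner_add_left, h₁, h₂]
  | smul _ _ _ h => simp only [Prod.smul_fst, Prod.smul_snd, inner_smul_left, h]

theorem norm_algTprod {n : ℕ} (x : Fin n → H) : ‖(algTprod x : AlgTensor H n)‖ = ∏ i, ‖x i‖ := by
  have h : ‖(algTprod x : AlgTensor H n)‖ ^ 2 = (∏ i, ‖x i‖) ^ 2 := by
    rw [← inner_self_eq_norm_sq (𝕜 := ℂ)]
    have h1 : inner ℂ (algTprod x : AlgTensor H n) (algTprod x)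
        = (((∏ i, ‖x i‖) ^ 2 : ℝ) : ℂ) := by
      refine (algForm_tprod x x).trans ?_
      simp [inner_self_eq_norm_sq_to_K, Finset.prod_pow]
    rw [h1]
    exact RCLike.ofReal_re (K := ℂ) _
  exact (pow_left_inj₀ (norm_nonneg _) (Finset.prod_nonneg fun _ _ => norm_nonneg _)
    two_ne_zero).1 h

theorem continuous_tensor (n : ℕ) : Continuous (tensor : (Fin n → H) → NParticle H n) := by
  have h := (MultilinearMap.mkContinuous (algTprod : MultilinearMap ℂ _ (AlgTensor H n)) 1
    fun x => by rw [norm_algTprod, one_mul]).cont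
  exact (UniformSpace.Completion.continuous_coe _).comp h

theorem graph_dGamma [CompleteSpace H] {A : H →ₗ.[ℂ] H} (hA : IsSelfAdjoint A) :
    (dGamma A).graph = (preGraph A).topologicalClosure := by
  have hsym : A.IsFormalAdjoint A := by
    have h := LinearPMap.adjoint_isFormalAdjoint (T := A) hA.dense_domain
    rwa [LinearPMap.isSelfAdjoint_def.1 hA] at h
  refine Submodule.toLinearPMap_graph_eq _ ?_
  rintro ⟨x, y⟩ hxy (rfl : x = 0)
  have key : ∀ q ∈ preGraph A, inner ℂ y q.1 = 0 := by
    intro q hq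
    have hc : IsClosed {p : Fock H × Fock H | inner ℂ p.1 q.2 = inner ℂ p.2 q.1} :=
      isClosed_eq (by fun_prop) (by fun_prop)
    have := closure_minimal (fun p hp => inner_preGraph hsym hp hq) hc hxy
    simpa using this.symm
  have h1 : ∀ (n : ℕ) (x : Fin n → A.domain), inner ℂ (tensor fun i => (x i : H)) (y n) = 0 := by
    intro n x
    have h := key _ (Submodule.subset_span ⟨n, x, rfl⟩)
    rw [← inner_incl, ← inner_conj_symm, h, map_zero]
  have h2 : ∀ (n : ℕ) (x : Fin n → H), inner ℂ (tensor x) (y n) = 0 := by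
    intro n x
    have hd : Dense (Set.univ.pi fun _ : Fin n => (A.domain : Set H)) :=
      dense_pi _ fun _ _ => hA.dense_domain
    have hc : IsClosed {x : Fin n → H | inner ℂ (tensor x) (y n) = 0} :=
      isClosed_eq ((continuous_tensor n).inner continuous_const) continuous_const
    refine closure_minimal (s := Set.univ.pi fun _ : Fin n => (A.domain : Set H)) ?_ hc (hd x)
    exact fun x hx => h1 n fun i => ⟨x i, hx i trivial⟩
  refine lp.ext (funext fun n => ?_)
  have h3 : ∀ t : AlgTensor H n, inner ℂ (t : NParticle H n) (y n) = 0 := by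
    intro t
    induction t using algTensor_induction with
    | h x => exact h2 n x
    | h0 => rw [UniformSpace.Completion.coe_zero, inner_zero_left]
    | hadd s t hs ht => rw [UniformSpace.Completion.coe_add, inner_add_left, hs, ht, add_zero]
    | hsmul c s hs => rw [UniformSpace.Completion.coe_smul, inner_smul_left, hs, mul_zero]
  have h4 : ∀ t : NParticle H n, inner ℂ t (y n) = 0 := fun t =>
    UniformSpace.Completion.induction_on t
      (isClosed_eq (continuous_id.inner continuous_const) continuous_const) h3
  exact inner_self_eq_zero.1 (h4 (y n))

end Fock

/-! ### Spectra of closed operators -/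

section Spectrum

variable {E : Type*} [NormedAddCommGroup E] [InnerProductSpace ℂ E]

/-- The map `T - z` on the domain of `T`. -/
def subScalar (T : E →ₗ.[ℂ] E) (z : ℂ) : T.domain →ₗ[ℂ] E :=
  T.toFun - z • T.domain.subtype

/-- The spectrum of a closed operator `T`: the `z` for which `T - z` is not a bijection from the
domain of `T` to the whole space. -/
def spec (T : E →ₗ.[ℂ] E) : Set ℂ :=
  {z | ¬ Function.Bijective (subScalar T z)}

/-- The continuous spectrum of a closed operator `T`: the `z` for which `T - z` is injective
with dense range, but not surjective. -/
def specC (T : E →ₗ.[ℂ] E) : Set ℂ :=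
  {z | Function.Injective (subScalar T z) ∧ DenseRange (subScalar T z) ∧
    ¬ Function.Surjective (subScalar T z)}

/-- `T` has the discrete spectral resolution given by the orthonormal basis `φ` and the real
eigenvalues `lam`. -/
def HasDiscreteResolution {ι : Type*} (T : E →ₗ.[ℂ] E) (φ : HilbertBasis ι ℂ E) (lam : ι → ℝ) :
    Prop :=
  ∀ j, ∃ h : φ j ∈ T.domain, T ⟨φ j, h⟩ = (lam j : ℂ) • φ j

/-- The set of the sums `z₁ + ⋯ + zₙ` with all `zⱼ` in `S`. -/
def nSum (n : ℕ) (S : Set ℂ) : Set ℂ :=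
  {w | ∃ z : Fin n → ℂ, (∀ j, z j ∈ S) ∧ w = ∑ j, z j}

end Spectrum

end SecondQuantization

end

noncomputable section

namespace SecondQuantization

/-! ### Tensor products of bounded operators -/

section TensorMap

variable {H : Type*} [NormedAddCommGroup H] [InnerProductSpace ℂ H] {n : ℕ}

/-! For a discrete spectrum everything is read off elementary tensors. The inner product of tensors
is a product, so tensors of basis vectors are orthonormal; multilinearity and continuity of `tensor`
make them total; the eigenvalue equation is the definition of `sumApply`.

For a continuous spectrum the tool is a partition of the spectrum of `A` at scale `ε`
(`SpectralPartition`), built from the continuous functional calculus of the normal operator `R = (A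
- i)⁻¹`, so that no spectral measure is needed. It consists of bounded self-adjoint operators `loc
k` with `∑ (loc k)² = 1` strongly, such that `A` differs from `ε k` on the range of `loc k` by an
operator of norm at most `ε`. The products `tloc K = loc K₁ ⊗ … ⊗ loc Kₙ` then form a partition of
the `n`-particle space, and on the range of `tloc K` the second quantization is `ε ∑ Kⱼ` up to an
error of norm at most `n ε`.

Absence of eigenvalues (`eq_zero_of_tact_eq`). An eigenvector `v` for `z` only has components `tloc
K v` with `∑ Kⱼ` within `n` of `Re z / ε`. Once `K₂, …, Kₙ` are fixed, at most `2 n + 1` values of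
`K₁` remain, whatever `ε` is. Since `A - z` has dense range for all `z`, the norms `‖loc k x‖` tend
to `0` uniformly in `k` as `ε → 0` (`exists_norm_funcCalc_le`): the spectral measure of `x` has no
atoms. A Cauchy-Schwarz estimate then makes `v` orthogonal to every elementary tensor. The same
argument applies to vectors orthogonal to the range, which gives dense range.

With dense range known, a point lies in the spectrum exactly when it is an approximate eigenvalue
(`mem_spec_iff`). Tensor products of approximate eigenvectors show that sums of spectral values are
spectral. Conversely, if `z` has positive distance from these sums, the operator minus `z` is
bounded below on each component `tloc K v`, hence on `v` (`spec_restrictTo_dGamma_subset`). If the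
spectrum is bounded on one side, the summands of a bounded sum stay in a compact set, so the set of
sums is already closed (`isClosed_nSum`). -/

/-- The algebraic tensor product `B₁ ⊗ … ⊗ Bₙ` of bounded operators. -/
def algMap (B : Fin n → H →L[ℂ] H) : AlgTensor H n →ₗ[ℂ] AlgTensor H n :=
  PiTensorProduct.lift (algTprod.compLinearMap fun i => (B i : H →ₗ[ℂ] H))

theorem algMap_tprod (B : Fin n → H →L[ℂ] H) (x : Fin n → H) :
    algMap B (algTprod x) = algTprod fun i => B i (x i) :=
  PiTensorProduct.lift.tprod x

theorem inner_algTprod (x y : Fin n → H) :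
    inner ℂ (algTprod x : AlgTensor H n) (algTprod y) = ∏ i, inner ℂ (x i) (y i) :=
  algForm_tprod x y

/-- `‖B‖² - B* B` is positive, hence of the form `C* C`. -/
theorem exists_inner_add_inner_eq [CompleteSpace H] (B : H →L[ℂ] H) :
    ∃ C : H →L[ℂ] H, ∀ x y : H,
      inner ℂ (B x) (B y) + inner ℂ (C x) (C y) = ((‖B‖ ^ 2 : ℝ) : ℂ) * inner ℂ x y := by
  have h := CStarAlgebra.star_mul_le_algebraMap_norm_sq (a := B)
  rw [← sub_nonneg, CStarAlgebra.nonneg_iff_eq_star_mul_self] at h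
  obtain ⟨C, hC⟩ := h
  refine ⟨C, fun x y => ?_⟩
  rw [← ContinuousLinearMap.adjoint_inner_right, ← ContinuousLinearMap.adjoint_inner_right C]
  have h1 : C.adjoint (C y) = (star C * C) y := rfl
  have h2 : B.adjoint (B y) = (star B * B) y := rfl
  rw [h1, h2, ← hC, ← inner_add_right]
  simp only [sub_apply, add_sub_cancel, Algebra.algebraMap_eq_smul_one]
  rw [smul_apply, one_apply_eq_self, inner_smul_right_eq_smul, Complex.real_smul]

/-- On elementary tensors this is the expansion of `∏ (bᵢ + cᵢ)` over the subsets of the indices;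
both sides are sesquilinear. -/
theorem sum_inner_algMap (B C : Fin n → H →L[ℂ] H) (c : Fin n → ℂ)
    (h : ∀ i x y, inner ℂ (B i x) (B i y) + inner ℂ (C i x) (C i y) = c i * inner ℂ x y)
    (s t : AlgTensor H n) :
    ∑ S : Finset (Fin n), inner ℂ (algMap (S.piecewise B C) s) (algMap (S.piecewise B C) t) =
      (∏ i, c i) * inner ℂ s t := by
  induction s using algTensor_induction with
  | h x =>
    induction t using algTensor_induction with
    | h y =>
      simp only [algMap_tprod, inner_algTprod, ← Finset.prod_mul_distrib, ← h]
      rw [Finset.prod_add]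
      simp only [Finset.powerset_univ]
      refine Finset.sum_congr rfl fun S _ => ?_
      rw [← Finset.prod_mul_prod_compl S, Finset.compl_eq_univ_sdiff]
      congr 1
      · exact Finset.prod_congr rfl fun i hi => by simp [hi]
      · exact Finset.prod_congr rfl fun i hi => by simp [(Finset.mem_sdiff.1 hi).2]
    | h0 => simp
    | hadd s t hs ht => simp only [map_add, inner_add_right, Finset.sum_add_distrib, hs, ht, mul_add]
    | hsmul c s hs =>
      simp only [map_smul, inner_smul_right, ← Finset.mul_sum, hs]
      ring
  | h0 => simp
  | hadd s t hs ht => simp only [map_add, inner_add_left, Finset.sum_add_distrib, hs, ht, mul_add]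
  | hsmul c s hs =>
    simp only [map_smul, inner_smul_left, ← Finset.mul_sum, hs]
    ring

/-- With each `Bᵢ` completed by a `Cᵢ` to `‖Bᵢ‖²` times an isometry, `‖algMap B t‖²` is the summand
for the full subset in a sum of squares equal to `(∏ ‖Bᵢ‖)² ‖t‖²`. -/
theorem norm_algMap_le [CompleteSpace H] (B : Fin n → H →L[ℂ] H) (t : AlgTensor H n) :
    ‖algMap B t‖ ≤ (∏ i, ‖B i‖) * ‖t‖ := by
  choose C hC using fun i => exists_inner_add_inner_eq (B i)
  have h : ∑ S : Finset (Fin n), ‖algMap (S.piecewise B C) t‖ ^ 2 =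
      (∏ i, ‖B i‖ ^ 2) * ‖t‖ ^ 2 := by
    have h := sum_inner_algMap B C _ hC t t
    simp only [inner_self_eq_norm_sq_to_K] at h
    refine Complex.ofReal_injective ?_
    push_cast
    simpa using h
  have h1 : ‖algMap B t‖ ^ 2 ≤ ((∏ i, ‖B i‖) * ‖t‖) ^ 2 := by
    rw [mul_pow, ← Finset.prod_pow, ← h]
    have := Finset.single_le_sum (f := fun S : Finset (Fin n) =>
      ‖algMap (S.piecewise B C) t‖ ^ 2) (fun _ _ => sq_nonneg _) (Finset.mem_univ Finset.univ)
    simpa using this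
  exact (pow_le_pow_iff_left₀ (norm_nonneg _) (by positivity) two_ne_zero).1 h1

variable [CompleteSpace H]

/-- The bounded operator `B₁ ⊗ … ⊗ Bₙ` on the `n`-particle space. -/
def tensorMap (B : Fin n → H →L[ℂ] H) : NParticle H n →L[ℂ] NParticle H n :=
  ((algMap B).mkContinuous _ (norm_algMap_le B)).completion

theorem tensorMap_tensor (B : Fin n → H →L[ℂ] H) (x : Fin n → H) :
    tensorMap B (tensor x) = tensor fun i => B i (x i) := by
  rw [tensorMap, tensor, ContinuousLinearMap.completion_apply_coe]
  exact congrArg _ (algMap_tprod B x)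

omit [CompleteSpace H] in
theorem nParticle_induction {p : NParticle H n → Prop} (hp : IsClosed {v | p v})
    (h : ∀ x, p (tensor x)) (h0 : p 0) (hadd : ∀ v w, p v → p w → p (v + w))
    (hsmul : ∀ (c : ℂ) v, p v → p (c • v)) (v : NParticle H n) : p v := by
  refine UniformSpace.Completion.induction_on v hp fun t => ?_
  induction t using algTensor_induction with
  | h x => exact h x
  | h0 => rwa [UniformSpace.Completion.coe_zero]
  | hadd s t hs ht => rw [UniformSpace.Completion.coe_add]; exact hadd _ _ hs ht
  | hsmul c s hs => rw [UniformSpace.Completion.coe_smul]; exact hsmul _ _ hs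

omit [CompleteSpace H] in
theorem clm_ext_tensor {F : Type*} [NormedAddCommGroup F] [NormedSpace ℂ F]
    {S T : NParticle H n →L[ℂ] F} (h : ∀ x, S (tensor x) = T (tensor x)) : S = T := by
  ext v
  induction v using nParticle_induction with
  | hp => exact isClosed_eq S.continuous T.continuous
  | h x => exact h x
  | h0 => simp
  | hadd v w hv hw => simp [hv, hw]
  | hsmul c v hv => simp [hv]

theorem norm_tensorMap_le (B : Fin n → H →L[ℂ] H) : ‖tensorMap B‖ ≤ ∏ i, ‖B i‖ := by
  refine ContinuousLinearMap.opNorm_le_bound _ (Finset.prod_nonneg fun _ _ => norm_nonneg _)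
    fun v => ?_
  refine UniformSpace.Completion.induction_on v ?_ fun t => ?_
  · exact isClosed_le (by fun_prop) (by fun_prop)
  · rw [tensorMap, ContinuousLinearMap.completion_apply_coe, UniformSpace.Completion.norm_coe,
      UniformSpace.Completion.norm_coe]
    exact norm_algMap_le B t

theorem tensorMap_mul (B C : Fin n → H →L[ℂ] H) :
    tensorMap B * tensorMap C = tensorMap (B * C) := by
  refine clm_ext_tensor fun x => ?_
  rw [mul_apply_eq_comp, tensorMap_tensor, tensorMap_tensor, tensorMap_tensor]
  rfl

theorem tensorMap_mul_apply (B C : Fin n → H →L[ℂ] H) (v : NParticle H n) :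
    tensorMap B (tensorMap C v) = tensorMap (B * C) v := by
  rw [← tensorMap_mul]; rfl

theorem inner_tensorMap_left (B C : Fin n → H →L[ℂ] H)
    (h : ∀ i x y, inner ℂ (B i x) y = inner ℂ x (C i y)) (v w : NParticle H n) :
    inner ℂ (tensorMap B v) w = inner ℂ v (tensorMap C w) := by
  induction v using nParticle_induction with
  | hp => exact isClosed_eq (by fun_prop) (by fun_prop)
  | h x =>
    induction w using nParticle_induction with
    | hp => exact isClosed_eq (by fun_prop) (by fun_prop)
    | h y => simp [tensorMap_tensor, inner_tensor, h]
    | h0 => simp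
    | hadd v w hv hw => simp only [map_add, inner_add_right, hv, hw]
    | hsmul c v hv => simp only [map_smul, inner_smul_right, hv]
  | h0 => simp
  | hadd v w hv hw => simp only [map_add, inner_add_left, hv, hw]
  | hsmul c v hv => simp only [map_smul, inner_smul_left, hv]

/-- The elementary tensors as a multilinear map. -/
def tensorₘ (H : Type*) [NormedAddCommGroup H] [InnerProductSpace ℂ H] (n : ℕ) :
    MultilinearMap ℂ (fun _ : Fin n => H) (NParticle H n) :=
  (UniformSpace.Completion.toComplL (𝕜 := ℂ) (E := AlgTensor H n)).toLinearMap.compMultilinearMap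
    algTprod

omit [CompleteSpace H] in
theorem tensorₘ_apply (x : Fin n → H) : tensorₘ H n x = tensor x := rfl

omit [CompleteSpace H] in
theorem norm_tensor (x : Fin n → H) : ‖tensor x‖ = ∏ i, ‖x i‖ :=
  (UniformSpace.Completion.norm_coe _).trans (norm_algTprod x)

theorem tensorMap_sum {κ : Type*} [DecidableEq κ] (s : Finset κ) (B : κ → H →L[ℂ] H) :
    ∑ K ∈ Fintype.piFinset fun _ : Fin n => s, tensorMap (fun i => B (K i)) =
      tensorMap fun _ => ∑ k ∈ s, B k := by
  refine clm_ext_tensor fun x => ?_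
  simp only [sum_apply, tensorMap_tensor]
  simp only [← tensorₘ_apply]
  exact ((tensorₘ H n).map_sum_finset (fun i k => B k (x i)) fun _ => s).symm

theorem isClosed_setOf_tendsto_self {E : Type*} [NormedAddCommGroup E] [NormedSpace ℂ E]
    {Q : ℕ → E →L[ℂ] E} (hQ : ∀ m, ‖Q m‖ ≤ 1) :
    IsClosed {v | Filter.Tendsto (fun m => Q m v) Filter.atTop (nhds v)} := by
  refine isClosed_of_closure_subset fun v hv => ?_
  rw [Set.mem_ofPred_eq, Metric.tendsto_atTop]
  intro ε hε
  obtain ⟨w, hw, hvw⟩ := Metric.mem_closure_iff.1 hv (ε / 3) (by positivity)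
  obtain ⟨N, hN⟩ := Metric.tendsto_atTop.1 hw (ε / 3) (by positivity)
  refine ⟨N, fun m hm => ?_⟩
  have h1 : dist (Q m v) (Q m w) ≤ dist v w := by
    rw [dist_eq_norm, dist_eq_norm, ← map_sub]
    exact ((Q m).le_of_opNorm_le (hQ m) _).trans_eq (one_mul _)
  have h2 := dist_triangle4_right (Q m v) v (Q m w) w
  have := hN m hm
  linarith

theorem tendsto_tensorMap {Q : ℕ → H →L[ℂ] H} (hQ : ∀ m, ‖Q m‖ ≤ 1)
    (h : ∀ x, Filter.Tendsto (fun m => Q m x) Filter.atTop (nhds x)) (v : NParticle H n) :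
    Filter.Tendsto (fun m => tensorMap (fun _ => Q m) v) Filter.atTop (nhds v) := by
  have hn : ∀ m, ‖tensorMap fun _ : Fin n => Q m‖ ≤ 1 := fun m =>
    (norm_tensorMap_le _).trans (Finset.prod_le_one (fun _ _ => norm_nonneg _) fun _ _ => hQ m)
  induction v using nParticle_induction with
  | hp => exact isClosed_setOf_tendsto_self hn
  | h x =>
    simp only [tensorMap_tensor]
    exact ((continuous_tensor n).tendsto x).comp (tendsto_pi_nhds.2 fun i => h (x i))
  | h0 => simp
  | hadd v w hv hw => simpa only [map_add] using hv.add hw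
  | hsmul c v hv => simpa only [map_smul] using hv.const_smul c

/-- The operator `1 ⊗ … ⊗ b ⊗ … ⊗ 1` with `b` in the `j`-th place. -/
def slot (j : Fin n) (b : H →L[ℂ] H) : NParticle H n →L[ℂ] NParticle H n :=
  tensorMap (Function.update 1 j b)

theorem slot_tensor (j : Fin n) (b : H →L[ℂ] H) (x : Fin n → H) :
    slot j b (tensor x) = tensor (Function.update x j (b (x j))) := by
  rw [slot, tensorMap_tensor]
  congr 1
  ext i
  rcases eq_or_ne i j with rfl | h
  · simp
  · simp [h]

theorem norm_slot_le (j : Fin n) (b : H →L[ℂ] H) : ‖slot j b‖ ≤ ‖b‖ := by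
  refine (norm_tensorMap_le _).trans ?_
  rw [← Finset.mul_prod_erase _ _ (Finset.mem_univ j)]
  simp only [Function.update_self]
  refine mul_le_of_le_one_right (norm_nonneg _)
    (Finset.prod_le_one (fun _ _ => norm_nonneg _) fun i hi => ?_)
  rw [Function.update_of_ne (Finset.ne_of_mem_erase hi)]
  exact ContinuousLinearMap.norm_id_le

end TensorMap

/-! ### Closed operators -/

section ClosedOperators

variable {E : Type*} [NormedAddCommGroup E] [InnerProductSpace ℂ E]

theorem subScalar_apply (T : E →ₗ.[ℂ] E) (z : ℂ) (x : T.domain) :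
    subScalar T z x = T x - z • (x : E) := rfl

variable [CompleteSpace E]

/-- The lower bound turns a convergent sequence of values into a Cauchy sequence of arguments, and
closedness puts the limit in the graph; so the dense range is closed. -/
theorem bijective_subScalar_of_le {T : E →ₗ.[ℂ] E} (hT : T.IsClosed) {z : ℂ}
    (hd : DenseRange (subScalar T z)) {c : ℝ} (hc : 0 < c)
    (h : ∀ x : T.domain, c * ‖x‖ ≤ ‖subScalar T z x‖) : Function.Bijective (subScalar T z) := by
  refine ⟨(injective_iff_map_eq_zero _).2 fun x hx => ?_, fun y => ?_⟩
  · have := h x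
    rw [hx, norm_zero] at this
    exact norm_eq_zero.1 (le_antisymm (by nlinarith) (norm_nonneg x))
  · have hy := hd y
    rw [mem_closure_iff_seq_limit] at hy
    obtain ⟨u, hu, hlim⟩ := hy
    choose x hx using hu
    have hcau : CauchySeq fun m => (x m : E) := by
      rw [Metric.cauchySeq_iff]
      intro ε hε
      obtain ⟨N, hN⟩ := Metric.cauchySeq_iff.1 hlim.cauchySeq (c * ε) (by positivity)
      refine ⟨N, fun m hm k hk => ?_⟩
      have h1 := hN m hm k hk
      rw [← hx, ← hx, dist_eq_norm, ← map_sub] at h1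
      have h2 := (h (x m - x k)).trans_lt h1
      rw [dist_eq_norm]
      exact lt_of_mul_lt_mul_left h2 hc.le
    obtain ⟨x₀, hx₀⟩ := cauchySeq_tendsto_of_complete hcau
    have hTx : Filter.Tendsto (fun m => T (x m)) Filter.atTop (nhds (y + z • x₀)) := by
      have h1 : ∀ m, T (x m) = u m + z • (x m : E) := fun m => by
        rw [← hx, subScalar_apply, sub_add_cancel]
      simp only [h1]
      exact hlim.add (hx₀.const_smul z)
    have hmem : (x₀, y + z • x₀) ∈ T.graph :=
      hT.mem_of_tendsto (hx₀.prodMk_nhds hTx)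
        (Filter.Eventually.of_forall fun m => T.mem_graph (x m))
    obtain ⟨w, hw, hw'⟩ := T.mem_graph_iff.1 hmem
    refine ⟨w, ?_⟩
    dsimp only at hw hw'
    rw [subScalar_apply, hw', hw, add_sub_cancel_right]

/-- The inverse has a closed graph, so it is bounded by the closed graph theorem. -/
theorem exists_le_of_bijective_subScalar {T : E →ₗ.[ℂ] E} (hT : T.IsClosed) {z : ℂ}
    (h : Function.Bijective (subScalar T z)) :
    ∃ c : ℝ, 0 < c ∧ ∀ x : T.domain, c * ‖x‖ ≤ ‖subScalar T z x‖ := by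
  set e := LinearEquiv.ofBijective (subScalar T z) h
  set g : E →ₗ[ℂ] E := T.domain.subtype ∘ₗ e.symm.toLinearMap
  have hg : Continuous g := by
    refine LinearMap.continuous_of_isClosed_graph g ?_
    have : (g.graph : Set (E × E)) = (fun p : E × E => (p.2, p.1 + z • p.2)) ⁻¹' T.graph := by
      ext ⟨y, x⟩
      simp only [SetLike.mem_coe, LinearMap.mem_graph_iff, Set.mem_preimage,
        LinearPMap.mem_graph_iff]
      constructor
      · rintro rfl
        refine ⟨e.symm y, rfl, ?_⟩
        have h1 : subScalar T z (e.symm y) = y := e.apply_symm_apply y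
        rw [subScalar_apply] at h1
        exact sub_eq_iff_eq_add.1 h1
      · rintro ⟨w, rfl, hw⟩
        have h1 : e w = y := by
          change subScalar T z w = y
          rw [subScalar_apply, hw, add_sub_cancel_right]
        rw [← h1]
        simp [g]
    rw [this]
    exact hT.preimage (by fun_prop)
  set G : E →L[ℂ] E := ⟨g, hg⟩
  refine ⟨(‖G‖ + 1)⁻¹, by positivity, fun x => ?_⟩
  have h1 : G (subScalar T z x) = x := by
    change ((e.symm (e x) : T.domain) : E) = x
    rw [e.symm_apply_apply]
  rw [inv_mul_le_iff₀ (by positivity)]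
  have h2 := G.le_opNorm (subScalar T z x)
  rw [h1] at h2
  have h3 := norm_nonneg (subScalar T z x)
  change ‖(x : E)‖ ≤ _
  linarith

theorem mem_spec_iff {T : E →ₗ.[ℂ] E} (hT : T.IsClosed) {z : ℂ}
    (hd : DenseRange (subScalar T z)) :
    z ∈ spec T ↔ ∀ c : ℝ, 0 < c → ∃ x : T.domain, ‖subScalar T z x‖ < c * ‖x‖ := by
  rw [spec, Set.mem_ofPred_eq, ← not_iff_not, not_not]
  push Not
  exact ⟨exists_le_of_bijective_subScalar hT, fun ⟨c, hc, h⟩ =>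
    bijective_subScalar_of_le hT hd hc h⟩

/-- An approximate eigenvector for `w` to precision `c / 2` is one for `z` to precision `c` when `|z
- w| < c / 2`. -/
theorem isClosed_spec {T : E →ₗ.[ℂ] E} (hT : T.IsClosed)
    (hd : ∀ z, DenseRange (subScalar T z)) : IsClosed (spec T) := by
  refine isClosed_of_closure_subset fun z hz => ?_
  rw [mem_spec_iff hT (hd z)]
  intro c hc
  obtain ⟨w, hw, hzw⟩ := Metric.mem_closure_iff.1 hz (c / 2) (by positivity)
  obtain ⟨x, hx⟩ := (mem_spec_iff hT (hd w)).1 hw (c / 2) (by positivity)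
  refine ⟨x, ?_⟩
  have h1 : subScalar T z x = subScalar T w x - (z - w) • (x : E) := by
    simp only [subScalar_apply, sub_smul]
    abel
  have h2 : ‖(z - w) • (x : E)‖ ≤ c / 2 * ‖x‖ := by
    rw [norm_smul, ← dist_eq_norm]
    exact mul_le_mul_of_nonneg_right hzw.le (norm_nonneg _)
  rw [h1]
  refine (norm_sub_le _ _).trans_lt ?_
  linarith

omit [CompleteSpace E] in
theorem injective_and_denseRange_of_spec_eq_specC {T : E →ₗ.[ℂ] E} (h : spec T = specC T) (z : ℂ) :
    Function.Injective (subScalar T z) ∧ DenseRange (subScalar T z) := by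
  by_cases hz : z ∈ spec T
  · rw [h] at hz
    exact ⟨hz.1, hz.2.1⟩
  · have hb : Function.Bijective (subScalar T z) := not_not.1 hz
    exact ⟨hb.1, hb.2.denseRange⟩

omit [CompleteSpace E] in
theorem spec_eq_specC {T : E →ₗ.[ℂ] E}
    (h : ∀ z, Function.Injective (subScalar T z) ∧ DenseRange (subScalar T z)) :
    spec T = specC T := by
  ext z
  simp [spec, specC, Function.Bijective, h z]

theorem IsSelfAdjoint.isFormalAdjoint {A : E →ₗ.[ℂ] E} (hA : IsSelfAdjoint A) :
    A.IsFormalAdjoint A := by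
  have h := LinearPMap.adjoint_isFormalAdjoint (T := A) hA.dense_domain
  rwa [LinearPMap.isSelfAdjoint_def.1 hA] at h

/-- `A - Re z` is symmetric, so its expectation in `x` is real, and the cross term, which carries a
factor `i`, has real part zero. -/
theorem norm_subScalar_sq {A : E →ₗ.[ℂ] E} (hA : IsSelfAdjoint A) (z : ℂ) (x : A.domain) :
    ‖subScalar A z x‖ ^ 2 = ‖A x - (z.re : ℂ) • (x : E)‖ ^ 2 + z.im ^ 2 * ‖x‖ ^ 2 := by
  have h1 : subScalar A z x =
      (A x - (z.re : ℂ) • (x : E)) - (z.im * Complex.I : ℂ) • (x : E) := by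
    rw [subScalar_apply, sub_sub, ← add_smul, Complex.re_add_im]
  have h2 : (inner ℂ (A x - (z.re : ℂ) • (x : E)) (x : E)).im = 0 := by
    rw [← Complex.conj_eq_iff_im, inner_conj_symm, inner_sub_left, inner_sub_right,
      inner_smul_left, inner_smul_right, IsSelfAdjoint.isFormalAdjoint hA x x, Complex.conj_ofReal]
  rw [h1, @norm_sub_sq ℂ, inner_smul_right, norm_smul, mul_assoc, RCLike.re_eq_complex_re,
    Complex.re_ofReal_mul, Complex.I_mul_re, h2]
  simp [mul_pow]

end ClosedOperators

/-! ### The restriction of the second quantization to the `n`-particle space -/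

section Restriction

variable {H : Type*} [NormedAddCommGroup H] [InnerProductSpace ℂ H] [CompleteSpace H]

omit [CompleteSpace H] in
theorem incl_continuous (n : ℕ) : Continuous (incl H n) :=
  (lp.singleContinuousLinearMap ℂ (fun n : ℕ => NParticle H n) 2 n).continuous

theorem mem_graph_restrictTo_dGamma {A : H →ₗ.[ℂ] H} (hA : IsSelfAdjoint A) {n : ℕ}
    (x : Fin n → A.domain) :
    (tensor fun i => (x i : H), sumApply A x) ∈ (restrictTo (dGamma A) n).graph := by
  rw [graph_restrictTo, graph_dGamma hA]
  exact Submodule.le_topologicalClosure _ (Submodule.subset_span ⟨n, x, rfl⟩)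

theorem isClosed_restrictTo_dGamma {A : H →ₗ.[ℂ] H} (hA : IsSelfAdjoint A) (n : ℕ) :
    (restrictTo (dGamma A) n).IsClosed := by
  rw [LinearPMap.IsClosed, graph_restrictTo, graph_dGamma hA]
  exact (preGraph A).isClosed_topologicalClosure.preimage
    (((incl_continuous n).comp continuous_fst).prodMk ((incl_continuous n).comp continuous_snd))

/-- Taking the `n`-th components is continuous and sends each generator of `preGraph A` to an
`n`-particle generator or to `0`. Hence passing to the closure in the whole Fock space adds nothing
to the `n`-particle graph beyond its own closure. -/
theorem restrictTo_dGamma_induction {A : H →ₗ.[ℂ] H} (hA : IsSelfAdjoint A) {n : ℕ}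
    {p : NParticle H n × NParticle H n → Prop} (hp : IsClosed {v | p v})
    (h : ∀ x : Fin n → A.domain, p (tensor fun i => (x i : H), sumApply A x)) (h0 : p 0)
    (hadd : ∀ v w, p v → p w → p (v + w)) (hsmul : ∀ (c : ℂ) v, p v → p (c • v))
    {v : NParticle H n × NParticle H n} (hv : v ∈ (restrictTo (dGamma A) n).graph) : p v := by
  rw [graph_restrictTo, graph_dGamma hA] at hv
  let π : Fock H × Fock H → NParticle H n × NParticle H n := fun q => (q.1 n, q.2 n)
  have hπ : Continuous π :=
    ((lp.evalCLM ℂ (fun n : ℕ => NParticle H n) 2 n).continuous.comp continuous_fst).prodMk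
      ((lp.evalCLM ℂ (fun n : ℕ => NParticle H n) 2 n).continuous.comp continuous_snd)
  have key : ((preGraph A).topologicalClosure : Set (Fock H × Fock H)) ⊆ π ⁻¹' {v | p v} := by
    refine closure_minimal (fun q hq => ?_) (hp.preimage hπ)
    change p (q.1 n, q.2 n)
    induction hq using Submodule.span_induction with
    | mem q hq =>
      obtain ⟨m, x, rfl⟩ := hq
      rcases eq_or_ne n m with rfl | hnm
      · simpa using h x
      · have h1 : ∀ y : NParticle H m, (incl H m y) n = 0 := fun y => by simp [hnm]
        simp only [h1]
        exact h0
    | zero => exact h0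
    | add _ _ _ _ h₁ h₂ => exact hadd _ _ h₁ h₂
    | smul c _ _ h => exact hsmul c _ h
  have := key hv
  simpa [π] using this

theorem hasDiscreteResolution_restrictTo_dGamma {A : H →ₗ.[ℂ] H} (hA : IsSelfAdjoint A)
    {ι : Type*} (φ : HilbertBasis ι ℂ H) (lam : ι → ℝ) (h : HasDiscreteResolution A φ lam)
    (n : ℕ) : ∃ Φ : HilbertBasis (Fin n → ι) ℂ (NParticle H n),
      (∀ i : Fin n → ι, Φ i = tensor fun j => φ (i j)) ∧
      HasDiscreteResolution (restrictTo (dGamma A) n) Φ (fun i => ∑ j, lam (i j)) := by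
  classical
  have hon : Orthonormal ℂ fun i : Fin n → ι => (tensor fun j => φ (i j) : NParticle H n) := by
    rw [orthonormal_iff_ite]
    intro i k
    rw [inner_tensor]
    simp only [orthonormal_iff_ite.1 φ.orthonormal, Finset.prod_ite_zero, funext_iff]
    simp
  have hd : ⊤ ≤ (Submodule.span ℂ
      (Set.range fun i : Fin n → ι => (tensor fun j => φ (i j) : NParticle H n))).topologicalClosure := by
    set W := Submodule.span ℂ
      (Set.range fun i : Fin n → ι => (tensor fun j => φ (i j) : NParticle H n))
    -- Multilinear expansion handles finite combinations of basis vectors; density and continuity of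
    -- `tensor` do the rest.
    have hspan : ∀ x : Fin n → H, (∀ j, x j ∈ Submodule.span ℂ (Set.range φ)) →
        tensor x ∈ W := by
      intro x hx
      have hx' : ∀ j, ∃ c : ι →₀ ℂ, c.sum (fun i a => a • φ i) = x j := fun j =>
        Finsupp.mem_span_range_iff_exists_finsupp.1 (hx j)
      choose c hc using hx'
      have : tensor x = tensorₘ H n fun j => ∑ i ∈ (c j).support, c j i • φ i := by
        rw [tensorₘ_apply]
        exact congrArg tensor (funext fun j => (hc j).symm)
      rw [this, MultilinearMap.map_sum_finset]
      refine Submodule.sum_mem _ fun r _ => ?_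
      rw [MultilinearMap.map_smul_univ]
      exact Submodule.smul_mem _ _ (Submodule.subset_span ⟨r, rfl⟩)
    intro v hv
    clear hv
    change v ∈ closure (W : Set (NParticle H n))
    induction v using nParticle_induction with
    | hp => exact isClosed_closure
    | h x =>
      have hdense : Dense (Set.univ.pi fun _ : Fin n => (Submodule.span ℂ (Set.range φ) : Set H)) :=
        dense_pi _ fun _ _ => Submodule.dense_iff_topologicalClosure_eq_top.2 φ.dense_span
      have hc : IsClosed {x : Fin n → H | tensor x ∈ closure (W : Set (NParticle H n))} :=
        isClosed_closure.preimage (continuous_tensor n)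
      refine closure_minimal (fun y hy => ?_) hc (hdense x)
      exact subset_closure (hspan y fun j => hy j trivial)
    | h0 => exact subset_closure W.zero_mem
    | hadd v w hv hw => exact W.topologicalClosure.add_mem hv hw
    | hsmul c v hv => exact W.topologicalClosure.smul_mem c hv
  refine ⟨HilbertBasis.mk hon hd, fun i => by rw [HilbertBasis.coe_mk], fun i => ?_⟩
  rw [HilbertBasis.coe_mk]
  choose hmem heq using h
  obtain ⟨w, hw, hw'⟩ := LinearPMap.mem_graph_iff _ |>.1
    (mem_graph_restrictTo_dGamma hA fun j => (⟨φ (i j), hmem (i j)⟩ : A.domain))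
  dsimp only at hw hw'
  refine ⟨hw ▸ w.2, ?_⟩
  have h1 : (⟨tensor fun j => φ (i j), hw ▸ w.2⟩ : (restrictTo (dGamma A) n).domain) = w :=
    Subtype.ext hw.symm
  rw [h1, hw', sumApply]
  simp only [heq, ← tensorₘ_apply, MultilinearMap.map_update_smul, Function.update_eq_self,
    ← Finset.sum_smul]
  push_cast
  rfl

end Restriction

/-! ### The resolvent of a self-adjoint operator and its functional calculus -/

section Resolvent

variable {H : Type*} [NormedAddCommGroup H] [InnerProductSpace ℂ H] [CompleteSpace H]

theorem denseRange_of_inner_eq_zero {V : Type*} [AddCommGroup V] [Module ℂ V] {f : V →ₗ[ℂ] H}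
    (h : ∀ v, (∀ x, inner ℂ v (f x) = 0) → v = 0) : DenseRange f := by
  have : (LinearMap.range f).topologicalClosure = ⊤ := by
    rw [Submodule.topologicalClosure_eq_top_iff, Submodule.eq_bot_iff]
    exact fun v hv => h v fun x => (Submodule.mem_orthogonal' _ v).1 hv _ ⟨x, rfl⟩
  have h1 := Submodule.dense_iff_topologicalClosure_eq_top.2 this
  rwa [LinearMap.coe_range] at h1

theorem abs_im_mul_norm_le {A : H →ₗ.[ℂ] H} (hA : IsSelfAdjoint A) (z : ℂ) (x : A.domain) :
    |z.im| * ‖x‖ ≤ ‖subScalar A z x‖ := by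
  refine (pow_le_pow_iff_left₀ (by positivity) (norm_nonneg _) two_ne_zero).1 ?_
  rw [norm_subScalar_sq hA, mul_pow, sq_abs]
  exact le_add_of_nonneg_left (sq_nonneg _)

/-- A vector `v` orthogonal to the range satisfies `A* v = conj z • v`. As `A* = A`, the lower bound
at `conj z` forces `v = 0`. -/
theorem bijective_subScalar_of_im_ne_zero {A : H →ₗ.[ℂ] H} (hA : IsSelfAdjoint A) {z : ℂ}
    (hz : z.im ≠ 0) : Function.Bijective (subScalar A z) := by
  refine bijective_subScalar_of_le hA.isClosed ?_ (abs_pos.2 hz) (abs_im_mul_norm_le hA z)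
  refine denseRange_of_inner_eq_zero fun v hv => ?_
  have hmem : (v, conj z • v) ∈ A.graph := by
    rw [← LinearPMap.isSelfAdjoint_def.1 hA,
      LinearPMap.adjoint_graph_eq_graph_adjoint hA.dense_domain, Submodule.mem_adjoint_iff]
    intro a b hab
    obtain ⟨x, hx, hx'⟩ := A.mem_graph_iff.1 hab
    dsimp only at hx hx'
    have h1 := hv x
    rw [subScalar_apply, hx, hx', ← inner_conj_symm, map_eq_zero, inner_sub_left,
      inner_smul_left] at h1
    rwa [inner_smul_right]
  obtain ⟨x, hx, hx'⟩ := A.mem_graph_iff.1 hmem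
  dsimp only at hx hx'
  have h1 := abs_im_mul_norm_le hA (conj z) x
  rw [subScalar_apply, hx', hx, sub_self, norm_zero, Complex.conj_im, abs_neg] at h1
  have h2 : ‖x‖ = 0 := le_antisymm (by nlinarith [abs_pos.2 hz]) (norm_nonneg x)
  rw [← hx, norm_eq_zero.1 h2, ZeroMemClass.coe_zero]

/-- `R` is the resolvent `(A - z)⁻¹`. -/
def IsResolvent (A : H →ₗ.[ℂ] H) (z : ℂ) (R : H →L[ℂ] H) : Prop :=
  ∀ x y, (x, y) ∈ A.graph ↔ R (y - z • x) = x

theorem exists_isResolvent {A : H →ₗ.[ℂ] H} (hA : IsSelfAdjoint A) {z : ℂ} (hz : z.im ≠ 0) :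
    ∃ R, IsResolvent A z R := by
  have hb := bijective_subScalar_of_im_ne_zero hA hz
  set e := LinearEquiv.ofBijective (subScalar A z) hb
  refine ⟨(A.domain.subtype ∘ₗ e.symm.toLinearMap).mkContinuous |z.im|⁻¹ fun y => ?_,
    fun x y => ?_⟩
  · rw [inv_mul_eq_div, le_div_iff₀ (abs_pos.2 hz), mul_comm]
    have := abs_im_mul_norm_le hA z (e.symm y)
    have h1 : subScalar A z (e.symm y) = y := e.apply_symm_apply y
    rwa [h1] at this
  · rw [LinearMap.mkContinuous_apply, LinearPMap.mem_graph_iff]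
    constructor
    · rintro ⟨w, rfl, rfl⟩
      change ((e.symm (e w) : A.domain) : H) = w
      rw [e.symm_apply_apply]
    · intro h
      refine ⟨e.symm (y - z • x), h, ?_⟩
      have h1 : subScalar A z (e.symm (y - z • x)) = y - z • x := e.apply_symm_apply _
      rw [subScalar_apply] at h1
      change ((e.symm (y - z • x) : A.domain) : H) = x at h
      rw [h] at h1
      exact sub_left_injective h1

omit [CompleteSpace H] in
theorem IsResolvent.mem_graph {A : H →ₗ.[ℂ] H} {z : ℂ} {R : H →L[ℂ] H} (hR : IsResolvent A z R)
    (y : H) : (R y, y + z • R y) ∈ A.graph := by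
  rw [hR, add_sub_cancel_right]

theorem inner_eq_of_mem_graph {A : H →ₗ.[ℂ] H} (hA : IsSelfAdjoint A) {x y u v : H}
    (h : (x, y) ∈ A.graph) (h' : (u, v) ∈ A.graph) : inner ℂ y u = inner ℂ x v := by
  obtain ⟨a, rfl, rfl⟩ := A.mem_graph_iff.1 h
  obtain ⟨b, rfl, rfl⟩ := A.mem_graph_iff.1 h'
  exact IsSelfAdjoint.isFormalAdjoint hA a b

variable {A : H →ₗ.[ℂ] H} {R : H →L[ℂ] H}

theorem IsResolvent.star_eq (hA : IsSelfAdjoint A) (hR : IsResolvent A Complex.I R)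
    {S : H →L[ℂ] H} (hS : IsResolvent A (-Complex.I) S) : star R = S := by
  rw [ContinuousLinearMap.star_eq_adjoint, eq_comm, ContinuousLinearMap.eq_adjoint_iff]
  intro w y
  have h := inner_eq_of_mem_graph hA (hR.mem_graph y) (hS.mem_graph w)
  rw [inner_add_left, inner_add_right, inner_smul_left, inner_smul_right, Complex.conj_I,
    add_left_inj] at h
  rw [← inner_conj_symm, h, inner_conj_symm]

/-- The resolvent identity for the points `i` and `-i`, in both orders; comparing the two gives
normality of `R`. -/
theorem IsResolvent.sub_star (hA : IsSelfAdjoint A) (hR : IsResolvent A Complex.I R) :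
    R - star R = (2 * Complex.I) • (star R * R) ∧ R - star R = (2 * Complex.I) • (R * star R) := by
  obtain ⟨S, hS⟩ := exists_isResolvent hA (z := -Complex.I) (by simp)
  rw [hR.star_eq hA hS]
  constructor
  · ext y
    have h := (hS _ _).1 (hR.mem_graph y)
    rw [neg_smul, sub_neg_eq_add, add_assoc, ← add_smul, ← two_mul, map_add, map_smul] at h
    change R y - S y = (2 * Complex.I) • S (R y)
    rw [sub_eq_iff_eq_add', h]
  · ext y
    have h := (hR _ _).1 (hS.mem_graph y)
    rw [neg_smul, ← sub_eq_add_neg, sub_sub, ← add_smul, ← two_mul, map_sub, map_smul] at h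
    change R y - S y = (2 * Complex.I) • R (S y)
    rw [sub_eq_iff_eq_add', ← sub_eq_iff_eq_add, h]

theorem IsResolvent.isStarNormal (hA : IsSelfAdjoint A) (hR : IsResolvent A Complex.I R) :
    IsStarNormal R := by
  obtain ⟨h1, h2⟩ := hR.sub_star hA
  refine ⟨smul_right_injective _ (by simp : (2 * Complex.I) ≠ 0) ?_⟩
  exact h1.symm.trans h2

/-- The identity `R - R* = 2 i R* R` passes to the spectrum through the functional calculus. The
resulting circle is the image of the real line together with `∞` under `t ↦ (t - i)⁻¹`. -/
theorem IsResolvent.normSq_eq (hA : IsSelfAdjoint A) (hR : IsResolvent A Complex.I R) {r : ℂ}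
    (hr : r ∈ spectrum ℂ R) : Complex.normSq r = r.im := by
  have := hR.isStarNormal hA
  have h1 : cfc (fun r : ℂ => r - star r - 2 * Complex.I * (star r * r)) R =
      cfc (0 : ℂ → ℂ) R := by
    rw [cfc_sub _ _ R, cfc_sub _ _ R, cfc_const_mul _ _ R, cfc_mul _ _ R, cfc_zero, cfc_id' ℂ R,
      cfc_star_id (a := R), (hR.sub_star hA).1, sub_self]
  have h2 : r - star r - 2 * Complex.I * (star r * r) = 0 := (cfc_eq_cfc_iff_eqOn (a := R)).1 h1 hr
  have h3 := congrArg Complex.im h2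
  simp [Complex.normSq_apply] at h3 ⊢
  linarith

/-! ### Functions of `A` as functions of its resolvent. -/

/-- The function of `r = (t - i)⁻¹` that corresponds to the function `h` of the real variable `t`,
with the value `0` at `r = 0`, that is, at `t = ∞`. -/
def pull (h : ℝ → ℝ) (r : ℂ) : ℂ :=
  if r = 0 then 0 else (h (r.re / Complex.normSq r) : ℂ)

theorem pull_zero (h : ℝ → ℝ) : pull h 0 = 0 := if_pos rfl

theorem pull_of_ne {h : ℝ → ℝ} {r : ℂ} (hr : r ≠ 0) :
    pull h r = (h (r.re / Complex.normSq r) : ℂ) := if_neg hr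

/-- On the circle, `r ↦ Re r / |r|²` inverts `t ↦ (t - i)⁻¹`. -/
theorem mul_sub_I_eq_one {r : ℂ} (hr : r ≠ 0) (hc : Complex.normSq r = r.im) :
    r * ((r.re / Complex.normSq r : ℝ) - Complex.I) = 1 := by
  have h0 : Complex.normSq r ≠ 0 := by simpa using hr
  have h1 : (Complex.normSq r : ℂ) ≠ 0 := by exact_mod_cast h0
  have h2 : ((r.re / Complex.normSq r : ℝ) - Complex.I : ℂ) = conj r / Complex.normSq r := by
    rw [eq_div_iff h1, sub_mul, Complex.ofReal_div, div_mul_cancel₀ _ h1]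
    apply Complex.ext <;> simp [hc]
  rw [h2, ← mul_div_assoc, Complex.mul_conj, div_self h1]

theorem norm_mul_abs_le_one {r : ℂ} (hr : r ≠ 0) (hc : Complex.normSq r = r.im) :
    ‖r‖ * |r.re / Complex.normSq r| ≤ 1 := by
  have h := congrArg norm (mul_sub_I_eq_one hr hc)
  rw [norm_mul, norm_one] at h
  rw [← h]
  refine mul_le_mul_of_nonneg_left ?_ (norm_nonneg _)
  simpa using Complex.abs_re_le_norm ((r.re / Complex.normSq r : ℝ) - Complex.I)

theorem norm_le_one_of_normSq_eq {r : ℂ} (hc : Complex.normSq r = r.im) : ‖r‖ ≤ 1 := by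
  have h1 := Complex.im_le_norm r
  rw [← hc, Complex.normSq_eq_norm_sq] at h1
  nlinarith [norm_nonneg r]

/-- `(t - i)⁻¹ - (u - i)⁻¹ = (u - t) (t - i)⁻¹ (u - i)⁻¹`, and both inverses have modulus at most
`1`. -/
theorem norm_sub_le_abs_sub {r s : ℂ} (hr : r ≠ 0) (hs : s ≠ 0) (hcr : Complex.normSq r = r.im)
    (hcs : Complex.normSq s = s.im) :
    ‖r - s‖ ≤ |r.re / Complex.normSq r - s.re / Complex.normSq s| := by
  have h1 := mul_sub_I_eq_one hr hcr
  have h2 := mul_sub_I_eq_one hs hcs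
  set t := r.re / Complex.normSq r
  set u := s.re / Complex.normSq s
  have h3 : s - r = r * s * ((t - u : ℝ) : ℂ) := by
    push_cast
    linear_combination (-s) * h1 + r * h2
  rw [norm_sub_rev, h3, norm_mul, norm_mul, Complex.norm_real, Real.norm_eq_abs]
  refine mul_le_of_le_one_left (abs_nonneg _) ?_
  exact mul_le_one₀ (norm_le_one_of_normSq_eq hcr) (norm_nonneg _) (norm_le_one_of_normSq_eq hcs)

/-- `h` is continuous and vanishes outside a bounded interval. -/
def IsCutoff (h : ℝ → ℝ) : Prop :=
  Continuous h ∧ ∃ N : ℝ, 0 ≤ N ∧ ∀ t, N ≤ |t| → h t = 0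

theorem IsCutoff.mul {h g : ℝ → ℝ} (hh : IsCutoff h) (hg : Continuous g) :
    IsCutoff fun t => g t * h t := by
  obtain ⟨hc, N, hN, h0⟩ := hh
  exact ⟨hg.mul hc, N, hN, fun t ht => by simp only [h0 t ht, mul_zero]⟩

/-- Only `r = 0` is critical. Small `r` on the circle correspond to large `|t|`, where the cutoff
vanishes. -/
theorem continuousOn_pull {h : ℝ → ℝ} (hh : IsCutoff h) :
    ContinuousOn (pull h) {r | Complex.normSq r = r.im} := by
  obtain ⟨hc, N, hN, h0⟩ := hh
  intro r hr
  rcases eq_or_ne r 0 with rfl | hr0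
  · have hev : ∀ᶠ s in nhdsWithin 0 {r : ℂ | Complex.normSq r = r.im}, pull h s = 0 := by
      rw [eventually_nhdsWithin_iff]
      filter_upwards [Metric.ball_mem_nhds (0 : ℂ) (ε := (N + 1)⁻¹) (by positivity)] with s hs hcs
      rcases eq_or_ne s 0 with rfl | hs0
      · exact pull_zero h
      rw [pull_of_ne hs0, h0, Complex.ofReal_zero]
      have h1 := congrArg norm (mul_sub_I_eq_one hs0 hcs)
      rw [norm_mul, norm_one] at h1
      have h2 : ‖((s.re / Complex.normSq s : ℝ) - Complex.I : ℂ)‖ ≤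
          |s.re / Complex.normSq s| + 1 := by
        refine (norm_sub_le _ _).trans_eq ?_
        rw [Complex.norm_real, Complex.norm_I, Real.norm_eq_abs]
      rw [mem_ball_zero_iff, lt_inv_comm₀ (norm_pos_iff.2 hs0) (by positivity)] at hs
      rw [mul_comm, ← eq_div_iff (norm_ne_zero_iff.2 hs0), one_div] at h1
      linarith
    refine ContinuousWithinAt.congr_of_eventuallyEq continuousWithinAt_const hev (pull_zero h)
  · have hcont : ContinuousAt (fun r : ℂ => (h (r.re / Complex.normSq r) : ℂ)) r := by
      refine Complex.continuous_ofReal.continuousAt.comp (hc.continuousAt.comp ?_)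
      exact Complex.continuous_re.continuousAt.div Complex.continuous_normSq.continuousAt
        (by simpa using hr0)
    refine (hcont.congr ?_).continuousWithinAt
    filter_upwards [isOpen_ne.mem_nhds hr0] with s hs
    exact (pull_of_ne hs).symm

theorem IsResolvent.continuousOn_pull (hA : IsSelfAdjoint A) (hR : IsResolvent A Complex.I R)
    {h : ℝ → ℝ} (hh : IsCutoff h) : ContinuousOn (pull h) (spectrum ℂ R) :=
  (SecondQuantization.continuousOn_pull hh).mono fun _ hr => hR.normSq_eq hA hr

/-- The operator `h(A)`, where `R = (A - i)⁻¹`. -/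
def funcCalc (R : H →L[ℂ] H) (h : ℝ → ℝ) : H →L[ℂ] H := cfc (pull h) R

theorem funcCalc_mul (hA : IsSelfAdjoint A) (hR : IsResolvent A Complex.I R) {h g : ℝ → ℝ}
    (hh : IsCutoff h) (hg : IsCutoff g) :
    funcCalc R h * funcCalc R g = funcCalc R fun t => h t * g t := by
  rw [funcCalc, funcCalc, ← cfc_mul _ _ R (hR.continuousOn_pull hA hh) (hR.continuousOn_pull hA hg)]
  refine cfc_congr fun r _ => ?_
  by_cases hr : r = 0 <;> simp [pull, hr]

theorem funcCalc_sum (hA : IsSelfAdjoint A) (hR : IsResolvent A Complex.I R) {κ : Type*}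
    (s : Finset κ) {h : κ → ℝ → ℝ} (hh : ∀ k, IsCutoff (h k)) :
    ∑ k ∈ s, funcCalc R (h k) = funcCalc R fun t => ∑ k ∈ s, h k t := by
  simp only [funcCalc]
  rw [← cfc_sum _ R s fun k _ => hR.continuousOn_pull hA (hh k)]
  refine cfc_congr fun r _ => ?_
  by_cases hr : r = 0 <;> simp [pull, hr]

theorem inner_funcCalc (R : H →L[ℂ] H) (h : ℝ → ℝ) (x y : H) :
    inner ℂ (funcCalc R h x) y = inner ℂ x (funcCalc R h y) := by
  have h1 : star (funcCalc R h) = funcCalc R h := by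
    rw [funcCalc, ← cfc_star]
    refine cfc_congr fun r _ => ?_
    by_cases hr : r = 0 <;> simp [pull, hr]
  rw [← ContinuousLinearMap.adjoint_inner_right, ← ContinuousLinearMap.star_eq_adjoint, h1]

theorem norm_pull_le {h : ℝ → ℝ} {c : ℝ} (hc : 0 ≤ c) (h1 : ∀ t, |h t| ≤ c) (r : ℂ) :
    ‖pull h r‖ ≤ c := by
  by_cases hr : r = 0
  · simpa [pull, hr] using hc
  · simpa [pull, hr] using h1 _

theorem norm_funcCalc_le (R : H →L[ℂ] H) {h : ℝ → ℝ} {c : ℝ} (hc : 0 ≤ c)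
    (h1 : ∀ t, |h t| ≤ c) : ‖funcCalc R h‖ ≤ c :=
  norm_cfc_le hc fun r _ => norm_pull_le hc h1 r

/-- On the spectrum of `R` this is `r (t - i) h(t) = h(t)`. The two orders serve different ends: one
shows that `h(A)` maps into the domain of `A`, the other that `h(A)` commutes with `A`. -/
theorem resolvent_mul_funcCalc (hA : IsSelfAdjoint A) (hR : IsResolvent A Complex.I R)
    {h : ℝ → ℝ} (hh : IsCutoff h) :
    R * (funcCalc R (fun t => t * h t) - Complex.I • funcCalc R h) = funcCalc R h ∧
      (funcCalc R (fun t => t * h t) - Complex.I • funcCalc R h) * R = funcCalc R h := by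
  have := hR.isStarNormal hA
  have c1 := hR.continuousOn_pull hA hh
  have c2 : ContinuousOn (pull fun t => t * h t) (spectrum ℂ R) :=
    hR.continuousOn_pull hA (hh.mul continuous_id)
  have c4 : ContinuousOn (fun r => Complex.I * pull h r) (spectrum ℂ R) :=
    continuousOn_const.mul c1
  have key : ∀ r ∈ spectrum ℂ R,
      r * (pull (fun t => t * h t) r - Complex.I * pull h r) = pull h r := by
    intro r hr
    rcases eq_or_ne r 0 with rfl | hr0
    · simp [pull_zero]
    · rw [pull_of_ne hr0, pull_of_ne hr0, Complex.ofReal_mul, ← sub_mul, ← mul_assoc,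
        mul_sub_I_eq_one hr0 (hR.normSq_eq hA hr), one_mul]
  have h1 : funcCalc R (fun t => t * h t) - Complex.I • funcCalc R h =
      cfc (fun r => pull (fun t => t * h t) r - Complex.I * pull h r) R := by
    rw [cfc_sub _ _ R c2 c4, cfc_const_mul _ _ R c1]
    rfl
  have c3 : ContinuousOn (fun r => pull (fun t => t * h t) r - Complex.I * pull h r)
      (spectrum ℂ R) := c2.sub c4
  have h2 : R * cfc (fun r => pull (fun t => t * h t) r - Complex.I * pull h r) R =
      funcCalc R h := by
    conv_lhs => enter [1]; rw [← cfc_id' ℂ R]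
    rw [← cfc_mul (fun r => r) _ R continuousOn_id c3]
    exact cfc_congr key
  refine ⟨by rw [h1, h2], ?_⟩
  rw [h1, ← h2]
  conv_lhs => enter [2]; rw [← cfc_id' ℂ R]
  conv_rhs => enter [1]; rw [← cfc_id' ℂ R]
  exact cfc_commute_cfc _ _ R

theorem funcCalc_mem_graph (hA : IsSelfAdjoint A) (hR : IsResolvent A Complex.I R)
    {h : ℝ → ℝ} (hh : IsCutoff h) (x : H) :
    (funcCalc R h x, funcCalc R (fun t => t * h t) x) ∈ A.graph := by
  rw [hR]
  exact congrArg (fun S : H →L[ℂ] H => S x) (resolvent_mul_funcCalc hA hR hh).1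

theorem funcCalc_apply_eq (hA : IsSelfAdjoint A) (hR : IsResolvent A Complex.I R)
    {h : ℝ → ℝ} (hh : IsCutoff h) {x y : H} (hxy : (x, y) ∈ A.graph) :
    funcCalc R h y = funcCalc R (fun t => t * h t) x := by
  have h1 := congrArg (fun S : H →L[ℂ] H => S (y - Complex.I • x))
    (resolvent_mul_funcCalc hA hR hh).2
  rw [hR] at hxy
  rw [mul_apply_eq_comp, hxy, sub_apply, smul_apply, map_sub, map_smul] at h1
  exact (sub_left_injective h1).symm

end Resolvent

/-! ### Localization in the spectrum -/

section Tent

/-- The tent function on `[-1, 1]`. -/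
def tent (u : ℝ) : ℝ := max 0 (1 - |u|)

theorem tent_nonneg (u : ℝ) : 0 ≤ tent u := le_max_left _ _

theorem tent_le_one (u : ℝ) : tent u ≤ 1 := max_le zero_le_one (by linarith [abs_nonneg u])

theorem tent_eq_zero {u : ℝ} (hu : 1 ≤ |u|) : tent u = 0 := max_eq_left (by linarith)

theorem continuous_tent : Continuous tent := by unfold tent; fun_prop

theorem tent_sub_eq_zero {u : ℝ} {k : ℤ} (hk : k ≠ ⌊u⌋) (hk' : k ≠ ⌊u⌋ + 1) :
    tent (u - k) = 0 := by
  refine tent_eq_zero ?_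
  rw [le_abs]
  rcases lt_or_gt_of_ne hk with h | h
  · left
    have h1 : (k : ℝ) + 1 ≤ ⌊u⌋ := by exact_mod_cast h
    linarith [Int.floor_le u]
  · right
    have h1 : (⌊u⌋ : ℝ) + 2 ≤ k := by
      have : ⌊u⌋ + 2 ≤ k := by omega
      exact_mod_cast this
    linarith [Int.lt_floor_add_one u]

theorem tent_pair (u : ℝ) : ∑ k ∈ ({⌊u⌋, ⌊u⌋ + 1} : Finset ℤ), tent (u - k) = 1 := by
  have h1 := Int.floor_le u
  have h2 := Int.lt_floor_add_one u
  rw [Finset.sum_pair (by omega), tent, tent, abs_of_nonneg (by linarith)]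
  push_cast
  rw [abs_of_nonpos (by linarith), max_eq_right (by linarith), max_eq_right (by linarith)]
  ring

theorem sum_tent_eq_one {u : ℝ} {s : Finset ℤ} (h : ⌊u⌋ ∈ s) (h' : ⌊u⌋ + 1 ∈ s) :
    ∑ k ∈ s, tent (u - k) = 1 := by
  rw [← tent_pair u]
  symm
  refine Finset.sum_subset (by simp [Finset.insert_subset_iff, h, h']) fun k _ hk => ?_
  simp only [Finset.mem_insert, Finset.mem_singleton, not_or] at hk
  exact tent_sub_eq_zero hk.1 hk.2

theorem sum_tent_le_one (u : ℝ) (s : Finset ℤ) : ∑ k ∈ s, tent (u - k) ≤ 1 := by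
  rw [← sum_tent_eq_one (u := u) (s := s ∪ {⌊u⌋, ⌊u⌋ + 1}) (by simp) (by simp)]
  exact Finset.sum_le_sum_of_subset_of_nonneg Finset.subset_union_left
    fun _ _ _ => tent_nonneg _

end Tent

/-! ### Spectral partitions of a self-adjoint operator. -/

section Localization

variable {H : Type*} [NormedAddCommGroup H] [InnerProductSpace ℂ H] [CompleteSpace H]

/-- Bounded operators `loc k` that localize the spectrum of `A` near the points `ε k`, `k ∈ ℤ`,
and bounded operators `err k` of norm at most `ε` that agree with `A - ε k` on the range
of `loc k`. -/
structure SpectralPartition (A : H →ₗ.[ℂ] H) (ε : ℝ) where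
  /-- the localizing operators -/
  loc : ℤ → H →L[ℂ] H
  /-- the operators that agree with `A - ε k` on the range of `loc k` -/
  err : ℤ → H →L[ℂ] H
  inner_loc : ∀ k x y, inner ℂ (loc k x) y = inner ℂ x (loc k y)
  inner_err : ∀ k x y, inner ℂ (err k x) y = inner ℂ x (err k y)
  err_mul_loc : ∀ k, err k * loc k = loc k * err k
  norm_err_le : ∀ k, ‖err k‖ ≤ ε
  loc_mem_graph : ∀ k x, (loc k x, ((ε * k : ℝ) : ℂ) • loc k x + err k (loc k x)) ∈ A.graph
  loc_apply : ∀ k x y, (x, y) ∈ A.graph →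
    loc k y = ((ε * k : ℝ) : ℂ) • loc k x + err k (loc k x)
  norm_sum_le : ∀ M : ℕ, ‖∑ k ∈ Finset.Icc (-M : ℤ) M, loc k * loc k‖ ≤ 1
  tendsto_sum : ∀ x, Filter.Tendsto
    (fun M : ℕ => (∑ k ∈ Finset.Icc (-M : ℤ) M, loc k * loc k) x) Filter.atTop (nhds x)
  exists_mem_spec : ∀ k, loc k ≠ 0 → ∃ t : ℝ, (t : ℂ) ∈ spec A ∧ |t - ε * k| ≤ ε

variable {A : H →ₗ.[ℂ] H} {R : H →L[ℂ] H}

/-- For `r = (t - i)⁻¹` one has `r - R = r (A - t) R`, so a bijective `A - t` would make `r - R`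
invertible. Thus nonzero spectral points of `R` come from spectral points of `A`. -/
theorem exists_mem_spec_of_funcCalc_ne_zero (hA : IsSelfAdjoint A)
    (hR : IsResolvent A Complex.I R) {h : ℝ → ℝ} (hh : funcCalc R h ≠ 0) :
    ∃ t : ℝ, (t : ℂ) ∈ spec A ∧ h t ≠ 0 := by
  obtain ⟨r, hr, hr'⟩ : ∃ r ∈ spectrum ℂ R, pull h r ≠ 0 := by
    by_contra! hcon
    refine hh ?_
    rw [funcCalc, cfc_congr (g := 0) (fun r hr => hcon r hr), cfc_zero]
  have hr0 : r ≠ 0 := by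
    rintro rfl
    exact hr' (pull_zero h)
  rw [pull_of_ne hr0, Complex.ofReal_ne_zero] at hr'
  have h1 := mul_sub_I_eq_one hr0 (hR.normSq_eq hA hr)
  set t := r.re / Complex.normSq r
  refine ⟨t, fun hb => spectrum.mem_iff.1 hr ?_, hr'⟩
  rw [ContinuousLinearMap.isUnit_iff_bijective]
  have hgr : ∀ y, ∃ x : A.domain, (x : H) = R y ∧ (algebraMap ℂ (H →L[ℂ] H) r - R) y =
      r • subScalar A t x := by
    intro y
    obtain ⟨x, hx, hx'⟩ := A.mem_graph_iff.1 (hR.mem_graph y)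
    dsimp only at hx hx'
    refine ⟨x, hx, ?_⟩
    rw [subScalar_apply, hx', hx, Algebra.algebraMap_eq_smul_one, sub_apply, smul_apply,
      one_apply_eq_self]
    have h2 : r * t - r * Complex.I = 1 := by rw [← mul_sub, h1]
    conv_lhs => enter [2]; rw [← one_smul ℂ (R y), ← h2]
    simp only [smul_sub, smul_add, sub_smul, mul_smul]
    abel
  constructor
  · refine (injective_iff_map_eq_zero _).2 fun y hy => ?_
    obtain ⟨x, hx, hx'⟩ := hgr y
    rw [hy, eq_comm, smul_eq_zero, or_iff_right hr0,
      map_eq_zero_iff _ hb.1] at hx'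
    have h3 : R y = 0 := by rw [← hx, hx', ZeroMemClass.coe_zero]
    have h4 := hR.mem_graph y
    rw [h3, smul_zero, add_zero] at h4
    exact A.graph_fst_eq_zero_snd h4 rfl
  · intro w
    obtain ⟨x, hx⟩ := hb.2 (r⁻¹ • w)
    refine ⟨A x - Complex.I • (x : H), ?_⟩
    obtain ⟨x', hx', hx''⟩ := hgr (A x - Complex.I • (x : H))
    rw [(hR _ _).1 (A.mem_graph x)] at hx'
    rw [hx'', Subtype.ext hx', hx, smul_inv_smul₀ hr0]

/-- Dense range lets `x` be approximated by `(R - r) w` for every `r`. If `h` lives near `r`, then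
`h(A) (R - r)` is small. Compactness of the spectrum of `R` makes the required closeness uniform. -/
theorem exists_norm_funcCalc_le (hA : IsSelfAdjoint A) (hR : IsResolvent A Complex.I R)
    (hd : ∀ z, DenseRange (subScalar A z)) (x : H) {η : ℝ} (hη : 0 < η) :
    ∃ δ > 0, ∀ h : ℝ → ℝ, IsCutoff h → (∀ t, |h t| ≤ 1) →
      (∀ s t, h s ≠ 0 → h t ≠ 0 → |s - t| < δ) → ‖funcCalc R h x‖ ≤ η := by
  have hnorm := hR.isStarNormal hA
  have hdr : ∀ r : ℂ, ∃ w, ‖x - (R w - r • w)‖ < η / 2 := by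
    intro r
    rcases eq_or_ne r 0 with rfl | hr
    · obtain ⟨y, hy, hxy⟩ := Metric.mem_closure_iff.1 (hA.dense_domain x) (η / 2) (by positivity)
      have h1 := (hR _ _).1 (A.mem_graph ⟨y, hy⟩)
      refine ⟨A ⟨y, hy⟩ - Complex.I • y, ?_⟩
      rw [h1, zero_smul, sub_zero, ← dist_eq_norm]
      exact hxy
    -- The point `i + r⁻¹` arises from `R - r = -r (A - i - r⁻¹) R`.
    · obtain ⟨_, ⟨y, rfl⟩, hy⟩ := Metric.mem_closure_iff.1 (hd (Complex.I + r⁻¹) (-r⁻¹ • x))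
        (‖r‖⁻¹ * (η / 2)) (by positivity)
      have h1 := (hR _ _).1 (A.mem_graph y)
      refine ⟨A y - Complex.I • (y : H), ?_⟩
      rw [h1]
      have h2 : x - ((y : H) - r • (A y - Complex.I • (y : H))) =
          -r • (-r⁻¹ • x - subScalar A (Complex.I + r⁻¹) y) := by
        rw [subScalar_apply, smul_sub (-r), smul_smul (-r), neg_mul_neg, mul_inv_cancel₀ hr,
          one_smul, smul_sub (-r), add_smul, smul_add, smul_smul (-r) r⁻¹, neg_mul,
          mul_inv_cancel₀ hr]
        simp only [smul_sub, neg_smul, one_smul]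
        abel
      rw [h2, norm_smul, norm_neg, ← dist_eq_norm]
      rwa [inv_mul_eq_div, lt_div_iff₀' (norm_pos_iff.2 hr)] at hy
  choose w hw using hdr
  -- The radius at `r` is adapted to the size of `w r`, so that `h(A) (R - r) (w r)` has norm at
  -- most `η / 2`; the `+ 1` avoids division by zero.
  obtain ⟨δ, hδ, hleb⟩ := lebesgue_number_lemma_of_metric (spectrum.isCompact (𝕜 := ℂ) R)
    (c := fun r : ℂ => Metric.ball r (η / (2 * (‖w r‖ + 1)))) (fun _ => Metric.isOpen_ball)
    (fun r _ => Set.mem_iUnion.2 ⟨r, Metric.mem_ball_self (by positivity)⟩)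
  refine ⟨δ, hδ, fun h hh h1 hsupp => ?_⟩
  by_cases hz : ∀ r ∈ spectrum ℂ R, pull h r = 0
  · rw [funcCalc, cfc_congr (g := 0) (fun r hr => hz r hr), cfc_zero]
    simpa using hη.le
  push Not at hz
  obtain ⟨r₁, hr₁, hpr₁⟩ := hz
  obtain ⟨r₀, hr₀⟩ := hleb r₁ hr₁
  have hball : ∀ r ∈ spectrum ℂ R, pull h r ≠ 0 → ‖r - r₀‖ ≤ η / (2 * (‖w r₀‖ + 1)) := by
    intro r hr hpr
    have hr0 : r ≠ 0 := by rintro rfl; exact hpr (pull_zero h)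
    have hr10 : r₁ ≠ 0 := by rintro rfl; exact hpr₁ (pull_zero h)
    rw [pull_of_ne hr0, Complex.ofReal_ne_zero] at hpr
    rw [pull_of_ne hr10, Complex.ofReal_ne_zero] at hpr₁
    have h2 : r ∈ Metric.ball r₁ δ := by
      rw [Metric.mem_ball, dist_eq_norm]
      exact (norm_sub_le_abs_sub hr0 hr10 (hR.normSq_eq hA hr) (hR.normSq_eq hA hr₁)).trans_lt
        (hsupp _ _ hpr hpr₁)
    have h3 := hr₀ h2
    rw [Metric.mem_ball, dist_eq_norm] at h3
    exact h3.le
  have hc := hR.continuousOn_pull hA hh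
  have hprod : ‖funcCalc R h * (R - algebraMap ℂ _ r₀)‖ ≤ η / (2 * (‖w r₀‖ + 1)) := by
    have h2 : R - algebraMap ℂ _ r₀ = cfc (fun r => r - r₀) R := by
      rw [cfc_sub _ _ R, cfc_id' ℂ R, cfc_const _ R]
    rw [h2, funcCalc, ← cfc_mul _ _ R hc (by fun_prop)]
    refine norm_cfc_le (by positivity) fun r hr => ?_
    by_cases hpr : pull h r = 0
    · rw [hpr, zero_mul, norm_zero]
      positivity
    · rw [norm_mul]
      exact (mul_le_of_le_one_left (norm_nonneg _) (norm_pull_le zero_le_one h1 r)).trans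
        (hball r hr hpr)
  have hsplit : funcCalc R h x = funcCalc R h (x - (R (w r₀) - r₀ • w r₀)) +
      (funcCalc R h * (R - algebraMap ℂ _ r₀)) (w r₀) := by
    rw [map_sub, mul_apply_eq_comp, sub_apply, Algebra.algebraMap_eq_smul_one, smul_apply,
      one_apply_eq_self, sub_add_cancel]
  rw [hsplit]
  refine (norm_add_le _ _).trans ?_
  have h4 := (funcCalc R h).le_of_opNorm_le (norm_funcCalc_le R zero_le_one h1)
    (x - (R (w r₀) - r₀ • w r₀))
  have h5 := ContinuousLinearMap.le_of_opNorm_le _ hprod (w r₀)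
  have h6 : η / (2 * (‖w r₀‖ + 1)) * ‖w r₀‖ ≤ η / 2 := by
    rw [div_mul_eq_mul_div, div_le_div_iff₀ (by positivity) two_pos]
    nlinarith [norm_nonneg (w r₀)]
  have h7 := hw r₀
  rw [one_mul] at h4
  linarith

theorem IsCutoff.of_abs_sub_le {h : ℝ → ℝ} (hc : Continuous h) {a c : ℝ}
    (h0 : ∀ t, c ≤ |t - a| → h t = 0) : IsCutoff h := by
  refine ⟨hc, max 0 (c + |a|), le_max_left _ _, fun t ht => h0 t ?_⟩
  have h1 := (le_max_right 0 (c + |a|)).trans ht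
  have h2 := abs_sub_abs_le_abs_sub t a
  linarith

/-- The square root of the tent function on `[ε (k - 1), ε (k + 1)]`. -/
def locFun (ε : ℝ) (k : ℤ) (t : ℝ) : ℝ := √(tent (t / ε - k))

/-- A cutoff of the function `t - ε k`. -/
def errFun (ε : ℝ) (k : ℤ) (t : ℝ) : ℝ :=
  ε * ((t / ε - k) * max 0 (min 1 (2 - |t / ε - k|)))

theorem abs_div_sub {ε : ℝ} (hε : 0 < ε) (k : ℤ) (t : ℝ) :
    |t / ε - k| = |t - ε * k| / ε := by
  rw [← abs_of_pos hε, ← abs_div, abs_of_pos hε, sub_div, mul_div_cancel_left₀ _ hε.ne']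

theorem isCutoff_locFun {ε : ℝ} (hε : 0 < ε) (k : ℤ) : IsCutoff (locFun ε k) := by
  refine IsCutoff.of_abs_sub_le (a := ε * k) (c := ε) ?_ fun t ht => ?_
  · exact Real.continuous_sqrt.comp (continuous_tent.comp (by fun_prop))
  · rw [locFun, tent_eq_zero, Real.sqrt_zero]
    rwa [abs_div_sub hε, one_le_div hε]

theorem isCutoff_errFun {ε : ℝ} (hε : 0 < ε) (k : ℤ) : IsCutoff (errFun ε k) := by
  refine IsCutoff.of_abs_sub_le (a := ε * k) (c := 2 * ε) ?_ fun t ht => ?_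
  · unfold errFun
    fun_prop
  · have : 2 ≤ |t / ε - k| := by rwa [abs_div_sub hε, le_div_iff₀ hε]
    rw [errFun, max_eq_left, mul_zero, mul_zero]
    exact (min_le_right _ _).trans (by linarith)

theorem abs_sub_lt_of_locFun_ne_zero {ε : ℝ} (hε : 0 < ε) {k : ℤ} {t : ℝ}
    (h : locFun ε k t ≠ 0) : |t - ε * k| < ε := by
  by_contra! hcon
  refine h ?_
  rw [locFun, tent_eq_zero, Real.sqrt_zero]
  rwa [abs_div_sub hε, one_le_div hε]

theorem abs_locFun_le_one (ε : ℝ) (k : ℤ) (t : ℝ) : |locFun ε k t| ≤ 1 := by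
  rw [locFun, abs_of_nonneg (Real.sqrt_nonneg _), Real.sqrt_le_one]
  exact tent_le_one _

theorem abs_errFun_le {ε : ℝ} (hε : 0 < ε) (k : ℤ) (t : ℝ) : |errFun ε k t| ≤ ε := by
  rw [errFun, abs_mul, abs_of_pos hε]
  refine mul_le_of_le_one_right hε.le ?_
  set u := t / ε - k
  rw [abs_mul, abs_of_nonneg (a := max _ _) (le_max_left _ _)]
  rcases le_total 2 |u| with h | h
  · rw [max_eq_left ((min_le_right _ _).trans (by linarith)), mul_zero]
    exact zero_le_one
  · have h1 : max 0 (min 1 (2 - |u|)) ≤ 2 - |u| := max_le (by linarith) (min_le_right _ _)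
    -- `|u| (2 - |u|) = 1 - (|u| - 1)² ≤ 1`.
    nlinarith [abs_nonneg u, sq_nonneg (|u| - 1)]

theorem mul_locFun {ε : ℝ} (hε : 0 < ε) (k : ℤ) (t : ℝ) :
    t * locFun ε k t = ε * k * locFun ε k t + errFun ε k t * locFun ε k t := by
  by_cases h : locFun ε k t = 0
  · simp [h]
  · have h1 : |t / ε - k| < 1 := by
      rw [abs_div_sub hε, div_lt_one hε]
      exact abs_sub_lt_of_locFun_ne_zero hε h
    rw [errFun, min_eq_left (by linarith), max_eq_right zero_le_one]
    field_simp
    ring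

theorem funcCalc_mul_locFun (hA : IsSelfAdjoint A) (hR : IsResolvent A Complex.I R) {ε : ℝ}
    (hε : 0 < ε) (k : ℤ) (x : H) :
    funcCalc R (fun t => t * locFun ε k t) x = ((ε * k : ℝ) : ℂ) • funcCalc R (locFun ε k) x +
      funcCalc R (errFun ε k) (funcCalc R (locFun ε k) x) := by
  have hl := isCutoff_locFun hε k
  have hb := isCutoff_errFun hε k
  have hc : ContinuousOn (fun r => ((ε * k : ℝ) : ℂ) * pull (locFun ε k) r) (spectrum ℂ R) :=
    continuousOn_const.mul (hR.continuousOn_pull hA hl)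
  rw [← mul_apply_eq_comp, funcCalc_mul hA hR hb hl, ← smul_apply, ← add_apply]
  congr 1
  rw [funcCalc, funcCalc, funcCalc, ← cfc_const_mul _ _ R (hR.continuousOn_pull hA hl),
    ← cfc_add _ _ _ hc (hR.continuousOn_pull hA (hl.mul hb.1))]
  refine cfc_congr fun r _ => ?_
  rcases eq_or_ne r 0 with rfl | hr
  · simp [pull_zero]
  · simp only [pull_of_ne hr, mul_locFun hε]
    push_cast
    ring

theorem sum_funcCalc_locFun (hA : IsSelfAdjoint A) (hR : IsResolvent A Complex.I R) {ε : ℝ}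
    (hε : 0 < ε) (s : Finset ℤ) :
    ∑ k ∈ s, funcCalc R (locFun ε k) * funcCalc R (locFun ε k) =
      funcCalc R fun t => ∑ k ∈ s, tent (t / ε - k) := by
  have h1 : ∀ k, funcCalc R (locFun ε k) * funcCalc R (locFun ε k) =
      funcCalc R fun t => locFun ε k t * locFun ε k t := fun k =>
    funcCalc_mul hA hR (isCutoff_locFun hε k) (isCutoff_locFun hε k)
  simp only [h1]
  rw [funcCalc_sum hA hR _ fun k => (isCutoff_locFun hε k).mul (isCutoff_locFun hε k).1]
  congr 1
  ext t
  exact Finset.sum_congr rfl fun k _ => Real.mul_self_sqrt (tent_nonneg _)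

theorem norm_sum_funcCalc_locFun_le (hA : IsSelfAdjoint A) (hR : IsResolvent A Complex.I R) {ε : ℝ}
    (hε : 0 < ε) (s : Finset ℤ) :
    ‖∑ k ∈ s, funcCalc R (locFun ε k) * funcCalc R (locFun ε k)‖ ≤ 1 := by
  rw [sum_funcCalc_locFun hA hR hε]
  refine norm_funcCalc_le R zero_le_one fun t => ?_
  rw [abs_of_nonneg (Finset.sum_nonneg fun _ _ => tent_nonneg _)]
  exact sum_tent_le_one _ _

theorem isCutoff_sum_tent {ε : ℝ} (hε : 0 < ε) (s : Finset ℤ) :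
    IsCutoff fun t => ∑ k ∈ s, tent (t / ε - k) := by
  refine ⟨continuous_finsetSum _ fun k _ => continuous_tent.comp (by fun_prop),
    ∑ k ∈ s, (ε + |ε * k|), Finset.sum_nonneg fun _ _ => by positivity, fun t ht => ?_⟩
  refine Finset.sum_eq_zero fun k hk => tent_eq_zero ?_
  rw [abs_div_sub hε, one_le_div hε]
  have h1 : ε + |ε * k| ≤ ∑ k ∈ s, (ε + |ε * k|) :=
    Finset.single_le_sum (f := fun k : ℤ => ε + |ε * k|) (fun _ _ => by positivity) hk
  have h2 := abs_sub_abs_le_abs_sub t (ε * k)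
  linarith

/-- The partial sums are uniformly bounded, so convergence need only be checked on the dense domain
of `A`, that is, on vectors `R w`. There the factor `r` gives decay at `t = ∞`. -/
theorem tendsto_sum_funcCalc_locFun (hA : IsSelfAdjoint A) (hR : IsResolvent A Complex.I R)
    {ε : ℝ} (hε : 0 < ε) (x : H) :
    Filter.Tendsto (fun M : ℕ => (∑ k ∈ Finset.Icc (-M : ℤ) M,
      funcCalc R (locFun ε k) * funcCalc R (locFun ε k)) x) Filter.atTop (nhds x) := by
  have hnorm := hR.isStarNormal hA
  refine closure_minimal ?_ (isClosed_setOf_tendsto_self fun M =>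
    norm_sum_funcCalc_locFun_le hA hR hε _) (hA.dense_domain x)
  intro y hy
  have hy' := (hR _ _).1 (A.mem_graph ⟨y, hy⟩)
  dsimp only at hy'
  rw [Set.mem_ofPred_eq, ← hy']
  set w := A ⟨y, hy⟩ - Complex.I • y
  -- Where the partial sum differs from `1`, `|t| ≥ ε M`; with `|r| |t| ≤ 1` and `|r| ≤ 1` this
  -- gives `|r| (M + 1) ≤ ε⁻¹ + 1 ≤ 2 max 1 ε⁻¹`.
  have hbound : ∀ M : ℕ, ‖(∑ k ∈ Finset.Icc (-M : ℤ) M,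
      funcCalc R (locFun ε k) * funcCalc R (locFun ε k)) (R w) - R w‖ ≤
      ((M : ℝ) + 1)⁻¹ * (max 1 ε⁻¹ * 2) * ‖w‖ := by
    intro M
    rw [sum_funcCalc_locFun hA hR hε]
    set q : ℝ → ℝ := fun t => ∑ k ∈ Finset.Icc (-M : ℤ) M, tent (t / ε - k)
    have hq := hR.continuousOn_pull hA (isCutoff_sum_tent hε (Finset.Icc (-M : ℤ) M))
    have h1 : funcCalc R q (R w) - R w = (cfc (fun r => (pull q r - 1) * r) R) w := by
      have hq' : ContinuousOn (fun r => pull q r - 1) (spectrum ℂ R) := hq.sub continuousOn_const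
      rw [cfc_mul _ (fun r => r) R hq' continuousOn_id, cfc_sub _ _ R hq,
        cfc_id' ℂ R, cfc_const_one ℂ R]
      rfl
    rw [h1]
    refine ContinuousLinearMap.le_of_opNorm_le _ (norm_cfc_le (by positivity) fun r hr => ?_) w
    rcases eq_or_ne r 0 with rfl | hr0
    · rw [mul_zero, norm_zero]
      positivity
    rw [pull_of_ne hr0]
    have hcirc := hR.normSq_eq hA hr
    have h2 := norm_mul_abs_le_one hr0 hcirc
    have h3 := norm_le_one_of_normSq_eq hcirc
    set t := r.re / Complex.normSq r
    have hq0 : 0 ≤ q t := Finset.sum_nonneg fun _ _ => tent_nonneg _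
    have hq1 : q t ≤ 1 := sum_tent_le_one _ _
    -- The strict upper bound keeps both `⌊t / ε⌋` and `⌊t / ε⌋ + 1`, the only indices that matter,
    -- inside the range of summation.
    by_cases ht : -(M : ℝ) ≤ t / ε ∧ t / ε < M
    · have h4 : q t = 1 := by
        refine sum_tent_eq_one ?_ ?_ <;> rw [Finset.mem_Icc]
        · have : ⌊t / ε⌋ < (M : ℤ) := Int.floor_lt.2 (by exact_mod_cast ht.2)
          exact ⟨Int.le_floor.2 (by exact_mod_cast ht.1), this.le⟩
        · have : ⌊t / ε⌋ < (M : ℤ) := Int.floor_lt.2 (by exact_mod_cast ht.2)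
          have h5 : (-M : ℤ) ≤ ⌊t / ε⌋ := Int.le_floor.2 (by exact_mod_cast ht.1)
          omega
      rw [h4, Complex.ofReal_one, sub_self, zero_mul, norm_zero]
      positivity
    · have h4 : (M : ℝ) ≤ |t| / ε := by
        have habs : |t| / ε = |t / ε| := by rw [abs_div t ε, abs_of_pos hε]
        rw [habs, le_abs]
        by_contra! hcon
        exact ht ⟨by linarith, hcon.1⟩
      rw [norm_mul]
      have h5 : ‖((q t : ℝ) : ℂ) - 1‖ ≤ 1 := by
        rw [← Complex.ofReal_one, ← Complex.ofReal_sub, Complex.norm_real, Real.norm_eq_abs,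
          abs_le]
        constructor <;> linarith
      refine (mul_le_of_le_one_left (norm_nonneg _) h5).trans ?_
      rw [inv_mul_eq_div, le_div_iff₀ (by positivity), mul_add, mul_one, mul_two]
      refine add_le_add ?_ (h3.trans (le_max_left _ _))
      refine le_trans ?_ (le_max_right _ _)
      calc ‖r‖ * M ≤ ‖r‖ * (|t| / ε) := by gcongr
        _ = ‖r‖ * |t| * ε⁻¹ := by ring
        _ ≤ ε⁻¹ := mul_le_of_le_one_left (by positivity) h2
  rw [tendsto_iff_norm_sub_tendsto_zero]
  refine squeeze_zero (fun _ => norm_nonneg _) hbound ?_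
  have := tendsto_one_div_add_atTop_nhds_zero_nat (𝕜 := ℝ)
  simp only [one_div] at this
  simpa [mul_assoc] using this.mul_const (max 1 ε⁻¹ * 2 * ‖w‖)

/-- The spectral partition that belongs to the functions `locFun` and `errFun`. -/
def spectralPartition (hA : IsSelfAdjoint A) (hR : IsResolvent A Complex.I R) {ε : ℝ}
    (hε : 0 < ε) : SpectralPartition A ε where
  loc k := funcCalc R (locFun ε k)
  err k := funcCalc R (errFun ε k)
  inner_loc k := inner_funcCalc R _
  inner_err k := inner_funcCalc R _
  err_mul_loc k := by
    rw [funcCalc_mul hA hR (isCutoff_errFun hε k) (isCutoff_locFun hε k),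
      funcCalc_mul hA hR (isCutoff_locFun hε k) (isCutoff_errFun hε k)]
    simp only [mul_comm]
  norm_err_le k := norm_funcCalc_le R hε.le (abs_errFun_le hε k)
  loc_mem_graph k x := by
    rw [← funcCalc_mul_locFun hA hR hε]
    exact funcCalc_mem_graph hA hR (isCutoff_locFun hε k) x
  loc_apply k x y hxy := by
    rw [← funcCalc_mul_locFun hA hR hε]
    exact funcCalc_apply_eq hA hR (isCutoff_locFun hε k) hxy
  norm_sum_le M := norm_sum_funcCalc_locFun_le hA hR hε _
  tendsto_sum := tendsto_sum_funcCalc_locFun hA hR hε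
  exists_mem_spec k hk := by
    obtain ⟨t, ht, ht'⟩ := exists_mem_spec_of_funcCalc_ne_zero hA hR hk
    exact ⟨t, ht, (abs_sub_lt_of_locFun_ne_zero hε ht').le⟩

theorem nonempty_spectralPartition (hA : IsSelfAdjoint A) {ε : ℝ} (hε : 0 < ε) :
    Nonempty (SpectralPartition A ε) := by
  obtain ⟨R, hR⟩ := exists_isResolvent hA (z := Complex.I) (by simp)
  exact ⟨spectralPartition hA hR hε⟩

theorem exists_spectralPartition_norm_loc_le (hA : IsSelfAdjoint A)
    (hd : ∀ z, DenseRange (subScalar A z)) (x : H) {η : ℝ} (hη : 0 < η) :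
    ∃ ε > 0, ∃ P : SpectralPartition A ε, ∀ k, ‖P.loc k x‖ ≤ η := by
  obtain ⟨R, hR⟩ := exists_isResolvent hA (z := Complex.I) (by simp)
  obtain ⟨δ, hδ, h⟩ := exists_norm_funcCalc_le hA hR hd x hη
  have hε : 0 < δ / 2 := by positivity
  refine ⟨δ / 2, hε, spectralPartition hA hR hε, fun k => ?_⟩
  refine h _ (isCutoff_locFun hε k) (abs_locFun_le_one _ k) fun s t hs ht => ?_
  have h1 := abs_lt.1 (abs_sub_lt_of_locFun_ne_zero hε hs)
  have h2 := abs_lt.1 (abs_sub_lt_of_locFun_ne_zero hε ht)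
  rw [abs_lt]
  constructor <;> linarith

end Localization

/-! ### Sums of spectral values -/

section NSum

/-- Near `z` the sums are bounded. As the summands are bounded on one side, each of them is bounded
too, and a compact set of tuples suffices. The sign `s` treats lower and upper bounds together. -/
theorem isClosed_nSum {S : Set ℂ} (hS : IsClosed S) (him : ∀ z ∈ S, z.im = 0) {s : ℝ}
    (hs : |s| = 1) {b : ℝ} (hb : ∀ z ∈ S, b ≤ s * z.re) (n : ℕ) : IsClosed (nSum n S) := by
  refine isClosed_of_closure_subset fun z hz => ?_
  set r := ‖z‖ + 1 + n * |b|
  set C : Set (Fin n → ℂ) := Set.univ.pi fun _ => S ∩ Metric.closedBall 0 (r + |b|)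
  have hC : IsCompact ((fun w : Fin n → ℂ => ∑ j, w j) '' C) :=
    (isCompact_univ_pi fun _ => (isCompact_closedBall _ _).inter_left hS).image (by fun_prop)
  have hsub : nSum n S ∩ Metric.ball z 1 ⊆ (fun w : Fin n → ℂ => ∑ j, w j) '' C := by
    rintro _ ⟨⟨w, hw, rfl⟩, hball⟩
    refine ⟨w, fun j _ => ⟨hw j, ?_⟩, rfl⟩
    have h1 : ‖∑ j, w j‖ ≤ ‖z‖ + 1 := by
      rw [Metric.mem_ball, dist_eq_norm] at hball
      have := norm_add_le (∑ j, w j - z) z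
      rw [sub_add_cancel] at this
      linarith
    have h2 : s * (∑ j, w j).re ≤ ‖z‖ + 1 := by
      refine (le_abs_self _).trans ?_
      rw [abs_mul, hs, one_mul]
      exact (Complex.abs_re_le_norm _).trans h1
    have h3 : s * (w j).re + |b| ≤ ∑ i, (s * (w i).re + |b|) :=
      Finset.single_le_sum (f := fun i => s * (w i).re + |b|)
        (fun i _ => by linarith [hb _ (hw i), neg_abs_le b]) (Finset.mem_univ j)
    rw [Finset.sum_add_distrib, ← Finset.mul_sum, ← Complex.re_sum] at h3
    simp only [Finset.sum_const, Finset.card_univ, Fintype.card_fin, nsmul_eq_mul] at h3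
    have h4 : ‖w j‖ = |s * (w j).re| := by
      rw [abs_mul, hs, one_mul]
      conv_lhs => rw [← Complex.re_add_im (w j), him _ (hw j)]
      simp
    rw [mem_closedBall_zero_iff, h4, abs_le]
    have h5 := hb _ (hw j)
    have h6 := neg_abs_le b
    have h7 := abs_nonneg b
    have h8 : 0 ≤ r := by positivity
    constructor <;> simp only [r] at * <;> linarith
  have h1 : z ∈ closure (nSum n S ∩ Metric.ball z 1) :=
    Metric.isOpen_ball.closure_inter ⟨hz, Metric.mem_ball_self one_pos⟩
  obtain ⟨w, hw, rfl⟩ := closure_minimal hsub hC.isClosed h1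
  exact ⟨w, fun j => (hw j trivial).1, rfl⟩

/-- Once the tail of `K` is fixed, `K 0` ranges over the integers of an interval of length `2 r`, at
most `2 r + 1` of them, each contributing at most `B`. The sum over the tails factorizes. -/
theorem sum_filter_prod_le {m : ℕ} (s : Finset ℤ) (a : Fin (m + 1) → ℤ → ℝ)
    (ha : ∀ j k, 0 ≤ a j k) {B : ℝ} (hB : ∀ k, a 0 k ≤ B) (c r : ℝ) (hr : 0 ≤ r) :
    ∑ K ∈ Fintype.piFinset fun _ : Fin (m + 1) => s,
        (if |(∑ j, (K j : ℝ)) - c| ≤ r then ∏ j, a j (K j) else 0) ≤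
      (2 * r + 1) * B * ∏ j : Fin m, ∑ k ∈ s, a j.succ k := by
  classical
  rw [Finset.prod_univ_sum, Finset.mul_sum, ← Finset.sum_filter,
    ← Finset.sum_fiberwise_of_maps_to (g := Fin.tail)
      (t := Fintype.piFinset fun _ : Fin m => s)
      (fun K hK => Fintype.mem_piFinset.2 fun j =>
        Fintype.mem_piFinset.1 (Finset.mem_filter.1 hK).1 j.succ)]
  refine Finset.sum_le_sum fun L _ => ?_
  set F := ((Fintype.piFinset fun _ : Fin (m + 1) => s).filter
    (fun K => |(∑ j, (K j : ℝ)) - c| ≤ r)).filter fun K => Fin.tail K = L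
  have hB0 : 0 ≤ B := (ha 0 0).trans (hB 0)
  have hcard : (F.card : ℝ) ≤ 2 * r + 1 := by
    set d := c - ∑ j, (L j : ℝ)
    have h1 : F.card ≤ (Finset.Icc ⌈d - r⌉ ⌊d + r⌋).card := by
      refine Finset.card_le_card_of_injOn (fun K => K 0) (fun K hK => ?_) fun K hK K' hK' h => ?_
      · obtain ⟨hK1, hK2⟩ := Finset.mem_filter.1 hK
        have h2 := (Finset.mem_filter.1 hK1).2
        rw [Fin.sum_univ_succ] at h2
        have h3 : ∑ j : Fin m, (K j.succ : ℝ) = ∑ j, (L j : ℝ) := by rw [← hK2]; rfl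
        rw [h3, abs_le] at h2
        rw [Finset.mem_coe, Finset.mem_Icc, Int.ceil_le, Int.le_floor]
        constructor <;> simp only [d] <;> linarith
      · have h2 := (Finset.mem_filter.1 hK).2.trans (Finset.mem_filter.1 hK').2.symm
        rw [← Fin.cons_self_tail K, ← Fin.cons_self_tail K', h2]
        exact congrArg (fun q => Fin.cons q (Fin.tail K')) h
    rw [Int.card_Icc] at h1
    have h2 : ((⌊d + r⌋ + 1 - ⌈d - r⌉).toNat : ℝ) ≤ 2 * r + 1 := by
      rcases le_total (⌊d + r⌋ + 1 - ⌈d - r⌉) 0 with h | h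
      · rw [Int.toNat_of_nonpos h]
        push_cast
        linarith
      · have h3 : ((⌊d + r⌋ + 1 - ⌈d - r⌉).toNat : ℝ) = ((⌊d + r⌋ + 1 - ⌈d - r⌉ : ℤ) : ℝ) := by
          exact_mod_cast congrArg (Int.cast (R := ℝ)) (Int.toNat_of_nonneg h)
        rw [h3]
        push_cast
        linarith [Int.floor_le (d + r), Int.le_ceil (d - r)]
    exact (Nat.cast_le.2 h1).trans h2
  have hP : 0 ≤ ∏ j : Fin m, a j.succ (L j) := Finset.prod_nonneg fun _ _ => ha _ _
  calc ∑ K ∈ F, ∏ j, a j (K j) ≤ ∑ K ∈ F, B * ∏ j : Fin m, a j.succ (L j) := by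
        refine Finset.sum_le_sum fun K hK => ?_
        rw [Fin.prod_univ_succ, ← (Finset.mem_filter.1 hK).2]
        exact mul_le_mul_of_nonneg_right (hB _) (Finset.prod_nonneg fun _ _ => ha _ _)
    _ = F.card * (B * ∏ j : Fin m, a j.succ (L j)) := by rw [Finset.sum_const, nsmul_eq_mul]
    _ ≤ (2 * r + 1) * (B * ∏ j : Fin m, a j.succ (L j)) := by gcongr
    _ = _ := by ring

end NSum

/-! ### Localization in the `n`-particle space -/

section NParticleLocalization

variable {H : Type*} [NormedAddCommGroup H] [InnerProductSpace ℂ H] [CompleteSpace H]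
  {A : H →ₗ.[ℂ] H} {ε : ℝ} {n : ℕ}

namespace SpectralPartition

/-- The tensor product of the localizing operators. -/
def tloc (P : SpectralPartition A ε) (K : Fin n → ℤ) : NParticle H n →L[ℂ] NParticle H n :=
  tensorMap fun j => P.loc (K j)

/-- The operator that agrees with `∑ⱼ 1 ⊗ … ⊗ (A - ε Kⱼ) ⊗ … ⊗ 1` on the range of `tloc K`. -/
def terr (P : SpectralPartition A ε) (K : Fin n → ℤ) : NParticle H n →L[ℂ] NParticle H n :=
  ∑ j, slot j (P.err (K j))

variable (P : SpectralPartition A ε)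

theorem inner_tloc (K : Fin n → ℤ) (v w : NParticle H n) :
    inner ℂ (P.tloc K v) w = inner ℂ v (P.tloc K w) :=
  inner_tensorMap_left _ _ (fun j => P.inner_loc (K j)) v w

theorem inner_terr (K : Fin n → ℤ) (v w : NParticle H n) :
    inner ℂ (P.terr K v) w = inner ℂ v (P.terr K w) := by
  simp only [terr, sum_apply, sum_inner, inner_sum]
  refine Finset.sum_congr rfl fun j _ => inner_tensorMap_left _ _ (fun i x y => ?_) v w
  rcases eq_or_ne i j with rfl | h
  · simpa using P.inner_err (K i) x y
  · simp [h]

theorem terr_tloc (K : Fin n → ℤ) (v : NParticle H n) :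
    P.terr K (P.tloc K v) = P.tloc K (P.terr K v) := by
  simp only [terr, sum_apply, map_sum]
  refine Finset.sum_congr rfl fun j _ => ?_
  rw [slot, tloc, tensorMap_mul_apply, tensorMap_mul_apply]
  congr 2
  ext1 i
  rcases eq_or_ne i j with rfl | h
  · simpa using P.err_mul_loc (K i)
  · simp [h]

theorem norm_terr_apply_le (K : Fin n → ℤ) (v : NParticle H n) :
    ‖P.terr K v‖ ≤ n * ε * ‖v‖ := by
  have h1 : ∀ j, ‖slot j (P.err (K j)) v‖ ≤ ε * ‖v‖ := fun j =>
    ContinuousLinearMap.le_of_opNorm_le _ ((norm_slot_le j _).trans (P.norm_err_le (K j))) v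
  rw [terr, sum_apply]
  refine (_root_.norm_sum_le _ _).trans ((Finset.sum_le_sum fun j _ => h1 j).trans_eq ?_)
  rw [Finset.sum_const, Finset.card_univ, Fintype.card_fin, nsmul_eq_mul, mul_assoc]

/-- The operator `(∑ⱼ 1 ⊗ … ⊗ A ⊗ … ⊗ 1) ∘ tloc K`. -/
def tact (P : SpectralPartition A ε) (K : Fin n → ℤ) : NParticle H n →L[ℂ] NParticle H n :=
  ((∑ j, ε * K j : ℝ) : ℂ) • P.tloc K + P.terr K * P.tloc K

theorem tact_apply (K : Fin n → ℤ) (v : NParticle H n) :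
    P.tact K v = ((∑ j, ε * K j : ℝ) : ℂ) • P.tloc K v + P.terr K (P.tloc K v) := rfl

theorem inner_tact (K : Fin n → ℤ) (v w : NParticle H n) :
    inner ℂ (P.tact K v) w = inner ℂ v (P.tact K w) := by
  rw [tact_apply, tact_apply, inner_add_left, inner_add_right, inner_smul_left, inner_smul_right,
    Complex.conj_ofReal, inner_tloc, inner_terr, inner_tloc, terr_tloc]

theorem sum_update_tloc (K : Fin n → ℤ) (x : Fin n → H) :
    ∑ j, tensor (Function.update (fun i => P.loc (K i) (x i)) j
      (((ε * K j : ℝ) : ℂ) • P.loc (K j) (x j) + P.err (K j) (P.loc (K j) (x j)))) =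
    P.tact K (tensor x) := by
  rw [tact_apply, tloc, tensorMap_tensor, terr, sum_apply, Complex.ofReal_sum, Finset.sum_smul,
    ← Finset.sum_add_distrib]
  refine Finset.sum_congr rfl fun j _ => ?_
  rw [slot_tensor]
  simp only [← tensorₘ_apply]
  rw [MultilinearMap.map_update_add, MultilinearMap.map_update_smul, Function.update_eq_self]

theorem tloc_apply (hA : IsSelfAdjoint A) (K : Fin n → ℤ) {v w : NParticle H n}
    (h : (v, w) ∈ (restrictTo (dGamma A) n).graph) : P.tloc K w = P.tact K v := by
  refine restrictTo_dGamma_induction hA (p := fun q => P.tloc K q.2 = P.tact K q.1) ?_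
    (fun x => ?_) ?_ (fun q q' hq hq' => ?_) (fun c q hq => ?_) h
  · exact isClosed_eq ((P.tloc K).continuous.comp continuous_snd)
      ((P.tact K).continuous.comp continuous_fst)
  · dsimp only
    rw [← sum_update_tloc, sumApply, map_sum]
    refine Finset.sum_congr rfl fun j _ => ?_
    rw [tloc, tensorMap_tensor, ← P.loc_apply (K j) _ _ (A.mem_graph (x j))]
    congr 1
    ext1 i
    rcases eq_or_ne i j with rfl | hij
    · rw [Function.update_self, Function.update_self]
    · rw [Function.update_of_ne hij, Function.update_of_ne hij]
  · rw [Prod.fst_zero, Prod.snd_zero, map_zero, map_zero]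
  · rw [Prod.fst_add, Prod.snd_add, map_add, map_add, hq, hq']
  · rw [Prod.smul_fst, Prod.smul_snd, map_smul, map_smul, hq]

theorem tloc_mem_graph (hA : IsSelfAdjoint A) (K : Fin n → ℤ) (v : NParticle H n) :
    (P.tloc K v, P.tact K v) ∈ (restrictTo (dGamma A) n).graph := by
  induction v using nParticle_induction with
  | hp =>
    exact (isClosed_restrictTo_dGamma hA n).preimage
      ((P.tloc K).continuous.prodMk (P.tact K).continuous)
  | h x =>
    rw [← sum_update_tloc, tloc, tensorMap_tensor]
    have h1 := fun j => (LinearPMap.mem_graph_iff _).1 (P.loc_mem_graph (K j) (x j))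
    choose y hy hy' using h1
    dsimp only at hy hy'
    have h2 := mem_graph_restrictTo_dGamma hA y
    simp only [sumApply, hy, hy'] at h2
    exact h2
  | h0 =>
    rw [map_zero, map_zero]
    exact Submodule.zero_mem _
  | hadd v w hv hw =>
    rw [map_add, map_add]
    exact Submodule.add_mem _ hv hw
  | hsmul c v hv =>
    rw [map_smul, map_smul]
    exact Submodule.smul_mem _ c hv

/-- The sum of the squares of the localizing operators `loc k` with `|k| ≤ M`. -/
def partialSum (M : ℕ) : H →L[ℂ] H := ∑ k ∈ Finset.Icc (-M : ℤ) M, P.loc k * P.loc k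

theorem sum_tloc_tloc (M : ℕ) (v : NParticle H n) :
    ∑ K ∈ Fintype.piFinset fun _ : Fin n => Finset.Icc (-M : ℤ) M, P.tloc K (P.tloc K v) =
      tensorMap (fun _ => P.partialSum M) v := by
  rw [partialSum, ← tensorMap_sum, sum_apply]
  refine Finset.sum_congr rfl fun K _ => ?_
  rw [tloc, tensorMap_mul_apply]
  rfl

theorem tendsto_tensorMap_partialSum (v : NParticle H n) :
    Filter.Tendsto (fun M : ℕ => tensorMap (fun _ => P.partialSum M) v) Filter.atTop (nhds v) :=
  tendsto_tensorMap P.norm_sum_le P.tendsto_sum v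

theorem sum_inner_tloc (M : ℕ) (v w : NParticle H n) :
    ∑ K ∈ Fintype.piFinset fun _ : Fin n => Finset.Icc (-M : ℤ) M,
      inner ℂ (P.tloc K v) (P.tloc K w) = inner ℂ v (tensorMap (fun _ => P.partialSum M) w) := by
  rw [← sum_tloc_tloc, inner_sum]
  exact Finset.sum_congr rfl fun K _ => P.inner_tloc K _ _

theorem sum_norm_tloc_sq (M : ℕ) (v : NParticle H n) :
    ∑ K ∈ Fintype.piFinset fun _ : Fin n => Finset.Icc (-M : ℤ) M, ‖P.tloc K v‖ ^ 2 =
      (inner ℂ v (tensorMap (fun _ => P.partialSum M) v)).re := by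
  rw [← sum_inner_tloc, Complex.re_sum]
  exact Finset.sum_congr rfl fun K _ => (inner_self_eq_norm_sq (𝕜 := ℂ) _).symm

theorem sum_norm_tloc_sq_le (M : ℕ) (v : NParticle H n) :
    ∑ K ∈ Fintype.piFinset fun _ : Fin n => Finset.Icc (-M : ℤ) M, ‖P.tloc K v‖ ^ 2 ≤
      ‖v‖ ^ 2 := by
  rw [sum_norm_tloc_sq]
  refine (Complex.re_le_norm _).trans ((norm_inner_le_norm _ _).trans ?_)
  rw [sq]
  refine mul_le_mul_of_nonneg_left ?_ (norm_nonneg _)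
  refine (ContinuousLinearMap.le_of_opNorm_le _ (c := 1) ?_ v).trans_eq (one_mul _)
  exact (norm_tensorMap_le _).trans
    (Finset.prod_le_one (fun _ _ => norm_nonneg _) fun _ _ => P.norm_sum_le M)

theorem tendsto_sum_norm_tloc_sq (v : NParticle H n) :
    Filter.Tendsto (fun M : ℕ => ∑ K ∈ Fintype.piFinset fun _ : Fin n => Finset.Icc (-M : ℤ) M,
      ‖P.tloc K v‖ ^ 2) Filter.atTop (nhds (‖v‖ ^ 2)) := by
  simp only [sum_norm_tloc_sq]
  rw [← inner_self_eq_norm_sq (𝕜 := ℂ) v]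
  exact (Complex.continuous_re.tendsto _).comp
    (tendsto_const_nhds.inner (P.tendsto_tensorMap_partialSum v))

omit [CompleteSpace H] in
theorem sum_norm_loc_sq_le (M : ℕ) (x : H) :
    ∑ k ∈ Finset.Icc (-M : ℤ) M, ‖P.loc k x‖ ^ 2 ≤ ‖x‖ ^ 2 := by
  have h : ∑ k ∈ Finset.Icc (-M : ℤ) M, ‖P.loc k x‖ ^ 2 =
      (inner ℂ x (P.partialSum M x)).re := by
    rw [partialSum, sum_apply, inner_sum, Complex.re_sum]
    refine Finset.sum_congr rfl fun k _ => ?_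
    rw [mul_apply_eq_comp, ← P.inner_loc]
    exact (inner_self_eq_norm_sq (𝕜 := ℂ) _).symm
  rw [h]
  refine (Complex.re_le_norm _).trans ((norm_inner_le_norm _ _).trans ?_)
  rw [sq]
  exact mul_le_mul_of_nonneg_left
    ((ContinuousLinearMap.le_of_opNorm_le _ (P.norm_sum_le M) x).trans_eq (one_mul _))
    (norm_nonneg _)

end SpectralPartition

end NParticleLocalization

/-! ### The spectrum of the second quantization in the `n`-particle space -/

section SpectrumNParticle

variable {H : Type*} [NormedAddCommGroup H] [InnerProductSpace ℂ H] [CompleteSpace H]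
  {A : H →ₗ.[ℂ] H}

/-- The component `tloc K v` is moved by `terr K` exactly by the factor `z - ε ∑ Kⱼ`, and `terr K`
has norm at most `n ε`. -/
theorem SpectralPartition.abs_sub_le_of_tact_eq {ε : ℝ} (hε : 0 < ε) {n : ℕ}
    (P : SpectralPartition A ε) {z : ℂ} {K : Fin n → ℤ} {v : NParticle H n}
    (h : P.tact K v = z • P.tloc K v) (h0 : P.tloc K v ≠ 0) :
    |(∑ j, (K j : ℝ)) - z.re / ε| ≤ n := by
  have h1 : (z - ((∑ j, ε * K j : ℝ) : ℂ)) • P.tloc K v = P.terr K (P.tloc K v) := by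
    rw [sub_smul, ← h, P.tact_apply, add_sub_cancel_left]
  have h2 := P.norm_terr_apply_le K (P.tloc K v)
  rw [← h1, norm_smul] at h2
  have h3 := le_of_mul_le_mul_right h2 (norm_pos_iff.2 h0)
  have h4 := (Complex.abs_re_le_norm _).trans h3
  rw [Complex.sub_re, Complex.ofReal_re, ← Finset.mul_sum, abs_sub_comm] at h4
  have h5 : (∑ j, (K j : ℝ)) - z.re / ε = (ε * ∑ j, (K j : ℝ) - z.re) / ε := by
    field_simp
  rw [h5, abs_div, abs_of_pos hε, div_le_iff₀ hε]
  exact h4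

/-- Only the `K` near the hyperplane `∑ Kⱼ = Re z / ε` contribute. Cauchy-Schwarz and the counting
lemma give a bound whose constant depends on neither `ε` nor `M`. -/
theorem SpectralPartition.norm_inner_tensorMap_sq_le {ε : ℝ} (hε : 0 < ε) {m : ℕ}
    (P : SpectralPartition A ε) {z : ℂ} {v : NParticle H (m + 1)}
    (h : ∀ K, P.tact K v = z • P.tloc K v) (x : Fin (m + 1) → H) {η : ℝ}
    (hη : ∀ k, ‖P.loc k (x 0)‖ ≤ η) (M : ℕ) :
    ‖inner ℂ (tensor x) (tensorMap (fun _ => P.partialSum M) v)‖ ^ 2 ≤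
      η ^ 2 * ((2 * (m + 1) + 1) * (∏ j : Fin m, ‖x j.succ‖ ^ 2) * ‖v‖ ^ 2) := by
  classical
  set s := Fintype.piFinset fun _ : Fin (m + 1) => Finset.Icc (-M : ℤ) M
  let good : (Fin (m + 1) → ℤ) → Prop := fun K =>
    |(∑ j, (K j : ℝ)) - z.re / ε| ≤ ((m : ℝ) + 1)
  let f : (Fin (m + 1) → ℤ) → ℝ := fun K => if good K then ‖P.tloc K (tensor x)‖ else 0
  have hle : ‖inner ℂ (tensor x) (tensorMap (fun _ => P.partialSum M) v)‖ ≤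
      ∑ K ∈ s, f K * ‖P.tloc K v‖ := by
    rw [← P.sum_inner_tloc]
    refine (_root_.norm_sum_le _ _).trans (Finset.sum_le_sum fun K _ => ?_)
    by_cases hK : P.tloc K v = 0
    · rw [hK, inner_zero_right, norm_zero, norm_zero, mul_zero]
    · have hg : good K := by
        have := P.abs_sub_le_of_tact_eq hε (h K) hK
        rwa [Nat.cast_add, Nat.cast_one] at this
      simp only [f, if_pos hg]
      exact norm_inner_le_norm _ _
  have hf : ∑ K ∈ s, f K ^ 2 ≤
      (2 * (m + 1) + 1) * η ^ 2 * ∏ j : Fin m, ‖x j.succ‖ ^ 2 := by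
    have h1 : ∀ K, f K ^ 2 = if |(∑ j, (K j : ℝ)) - z.re / ε| ≤ ((m : ℝ) + 1) then
        ∏ j, ‖P.loc (K j) (x j)‖ ^ 2 else 0 := by
      intro K
      simp only [f, good]
      split_ifs
      · rw [SpectralPartition.tloc, tensorMap_tensor, norm_tensor, Finset.prod_pow]
      · exact zero_pow two_ne_zero
    simp only [h1]
    refine (sum_filter_prod_le (Finset.Icc (-M : ℤ) M) (fun j k => ‖P.loc k (x j)‖ ^ 2)
      (fun _ _ => sq_nonneg _) (B := η ^ 2)
      (fun k => pow_le_pow_left₀ (norm_nonneg _) (hη k) 2) _ _ (by positivity)).trans ?_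
    refine mul_le_mul_of_nonneg_left ?_ (by positivity)
    exact Finset.prod_le_prod (fun _ _ => Finset.sum_nonneg fun _ _ => sq_nonneg _)
      fun j _ => P.sum_norm_loc_sq_le M (x j.succ)
  calc _ ≤ (∑ K ∈ s, f K * ‖P.tloc K v‖) ^ 2 := pow_le_pow_left₀ (norm_nonneg _) hle 2
    _ ≤ (∑ K ∈ s, f K ^ 2) * ∑ K ∈ s, ‖P.tloc K v‖ ^ 2 := Finset.sum_mul_sq_le_sq_mul_sq _ _ _
    _ ≤ ((2 * (m + 1) + 1) * η ^ 2 * ∏ j : Fin m, ‖x j.succ‖ ^ 2) * ‖v‖ ^ 2 :=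
        mul_le_mul hf (P.sum_norm_tloc_sq_le M v) (Finset.sum_nonneg fun _ _ => sq_nonneg _)
          (by positivity)
    _ = _ := by ring

/-- The hypothesis is a weak eigenvalue equation that does not require `v` to be in the domain. It
therefore covers eigenvectors and vectors orthogonal to the range alike. -/
theorem eq_zero_of_tact_eq (hA : IsSelfAdjoint A) (hd : ∀ z, DenseRange (subScalar A z)) {m : ℕ}
    {z : ℂ} {v : NParticle H (m + 1)}
    (h : ∀ (ε : ℝ) (P : SpectralPartition A ε), 0 < ε → ∀ K, P.tact K v = z • P.tloc K v) :
    v = 0 := by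
  have key : ∀ x : Fin (m + 1) → H, inner ℂ (tensor x) v = 0 := by
    intro x
    set C := (2 * (m + 1) + 1) * (∏ j : Fin m, ‖x j.succ‖ ^ 2) * ‖v‖ ^ 2
    have hle : ∀ η : ℝ, 0 < η → ‖inner ℂ (tensor x) v‖ ^ 2 ≤ η ^ 2 * C := by
      intro η hη
      obtain ⟨ε, hε, P, hP⟩ := exists_spectralPartition_norm_loc_le hA hd (x 0) hη
      refine le_of_tendsto' ((continuous_pow 2).tendsto _ |>.comp
        (tendsto_const_nhds.inner (P.tendsto_tensorMap_partialSum v)).norm) fun M => ?_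
      exact P.norm_inner_tensorMap_sq_le hε (h ε P hε) x hP M
    have hlim : Filter.Tendsto (fun η : ℝ => η ^ 2 * C) (nhdsWithin 0 (Set.Ioi 0)) (nhds 0) := by
      have : Continuous fun η : ℝ => η ^ 2 * C := by fun_prop
      simpa using (this.tendsto 0).mono_left nhdsWithin_le_nhds
    have h0 := ge_of_tendsto hlim (eventually_mem_nhdsWithin.mono hle)
    exact norm_eq_zero.1 (pow_eq_zero_iff two_ne_zero |>.1 (le_antisymm h0 (sq_nonneg _)))
  have h2 : innerSL ℂ v = 0 := clm_ext_tensor fun x => by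
    rw [innerSL_apply_apply, ← inner_conj_symm, key, map_zero, zero_apply]
  have h3 : inner ℂ v v = 0 := by
    rw [← innerSL_apply_apply (𝕜 := ℂ), h2, zero_apply]
  exact inner_self_eq_zero.1 h3

/-- Each `tloc K w` lies in the domain, so it may be used as a test vector; symmetry of `tloc K` and
`tact K` moves them to `v`. -/
theorem SpectralPartition.tact_eq_of_inner_eq_zero (hA : IsSelfAdjoint A) {ε : ℝ} {n : ℕ}
    (P : SpectralPartition A ε) {z : ℂ} {v : NParticle H n}
    (hv : ∀ x, inner ℂ v (subScalar (restrictTo (dGamma A) n) z x) = 0) (K : Fin n → ℤ) :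
    P.tact K v = conj z • P.tloc K v := by
  rw [← sub_eq_zero]
  refine ext_inner_right ℂ fun w => ?_
  rw [inner_zero_left]
  obtain ⟨x, hx, hx'⟩ := (LinearPMap.mem_graph_iff _).1 (P.tloc_mem_graph hA K w)
  have h1 := hv x
  rw [subScalar_apply, hx', hx, inner_sub_right, inner_smul_right] at h1
  rw [inner_sub_left, inner_smul_left, Complex.conj_conj, P.inner_tact, P.inner_tloc]
  exact h1

theorem injective_and_denseRange_restrictTo_dGamma (hA : IsSelfAdjoint A)
    (hd : ∀ z, DenseRange (subScalar A z)) (m : ℕ) (z : ℂ) :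
    Function.Injective (subScalar (restrictTo (dGamma A) (m + 1)) z) ∧
      DenseRange (subScalar (restrictTo (dGamma A) (m + 1)) z) := by
  constructor
  · refine (injective_iff_map_eq_zero _).2 fun x hx => ?_
    rw [subScalar_apply, sub_eq_zero] at hx
    refine Subtype.ext (eq_zero_of_tact_eq (z := z) hA hd fun ε P hε K => ?_)
    rw [← P.tloc_apply hA K (LinearPMap.mem_graph _ x), hx, map_smul]
  · exact denseRange_of_inner_eq_zero fun v hv => eq_zero_of_tact_eq (z := conj z) hA hd
      fun ε P hε K => P.tact_eq_of_inner_eq_zero hA hv K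

/-- A nonzero component forces every `loc (K j)` to be nonzero, so `ε Kⱼ` is within `ε` of a
spectral point. One loss of `n ε` comes from replacing `∑ ε Kⱼ` by a sum of spectral points, the
other from `terr K`. -/
theorem SpectralPartition.norm_tloc_le (hA : IsSelfAdjoint A) {ε : ℝ} {n : ℕ}
    (P : SpectralPartition A ε) {z : ℂ} {d : ℝ} (hd : ∀ w ∈ nSum n (spec A), d ≤ ‖w - z‖)
    {v w : NParticle H n} (h : (v, w) ∈ (restrictTo (dGamma A) n).graph) (K : Fin n → ℤ) :
    (d - 2 * n * ε) * ‖P.tloc K v‖ ≤ ‖P.tloc K (w - z • v)‖ := by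
  by_cases h0 : P.tloc K v = 0
  · rw [h0, norm_zero, mul_zero]
    exact norm_nonneg _
  have hne : ∀ j, P.loc (K j) ≠ 0 := by
    intro j hj
    have h1 : ‖P.tloc K‖ ≤ 0 := (norm_tensorMap_le _).trans_eq
      (Finset.prod_eq_zero (Finset.mem_univ j) (by rw [hj, norm_zero]))
    rw [norm_le_zero_iff.1 h1] at h0
    exact h0 rfl
  choose t ht ht' using fun j => P.exists_mem_spec (K j) (hne j)
  have h1 : ‖((∑ j, t j : ℝ) : ℂ) - ((∑ j, ε * K j : ℝ) : ℂ)‖ ≤ n * ε := by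
    rw [← Complex.ofReal_sub, ← Finset.sum_sub_distrib, Complex.norm_real]
    refine (_root_.norm_sum_le _ _).trans ((Finset.sum_le_sum fun j _ => ht' j).trans_eq ?_)
    simp
  have h2 := hd ((∑ j, t j : ℝ) : ℂ) ⟨fun j => t j, ht, Complex.ofReal_sum _ _⟩
  have h3 : d - n * ε ≤ ‖((∑ j, ε * K j : ℝ) : ℂ) - z‖ := by
    have := norm_sub_le_norm_sub_add_norm_sub ((∑ j, t j : ℝ) : ℂ) ((∑ j, ε * K j : ℝ) : ℂ) z
    linarith
  have h4 : P.tloc K (w - z • v) = (((∑ j, ε * K j : ℝ) : ℂ) - z) • P.tloc K v +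
      P.terr K (P.tloc K v) := by
    rw [map_sub, map_smul, P.tloc_apply hA K h, P.tact_apply, sub_smul]
    abel
  have h5 := P.norm_terr_apply_le K (P.tloc K v)
  have h6 := norm_sub_le_norm_add ((((∑ j, ε * K j : ℝ) : ℂ) - z) • P.tloc K v)
    (P.terr K (P.tloc K v))
  rw [norm_smul] at h6
  rw [h4]
  have h7 := mul_le_mul_of_nonneg_right h3 (norm_nonneg (P.tloc K v))
  linarith

theorem spec_restrictTo_dGamma_subset (hA : IsSelfAdjoint A)
    (hd : ∀ z, DenseRange (subScalar A z)) (m : ℕ) :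
    spec (restrictTo (dGamma A) (m + 1)) ⊆ closure (nSum (m + 1) (spec A)) := by
  intro z hz
  by_contra hcon
  rw [Metric.mem_closure_iff] at hcon
  push Not at hcon
  obtain ⟨d, hd0, hdist⟩ := hcon
  -- With this scale the two losses add up to `d / 2`, leaving the lower bound `d / 2`.
  have hε : 0 < d / (4 * (m + 1)) := by positivity
  obtain ⟨P⟩ := nonempty_spectralPartition hA hε
  have hd' : ∀ w ∈ nSum (m + 1) (spec A), d ≤ ‖w - z‖ := fun w hw => by
    rw [← dist_eq_norm, dist_comm]
    exact hdist w hw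
  refine hz (bijective_subScalar_of_le (isClosed_restrictTo_dGamma hA _)
    (injective_and_denseRange_restrictTo_dGamma hA hd m z).2 (half_pos hd0) fun x => ?_)
  refine (pow_le_pow_iff_left₀ (by positivity) (norm_nonneg _) two_ne_zero).1 ?_
  rw [mul_pow]
  refine le_of_tendsto_of_tendsto' ((P.tendsto_sum_norm_tloc_sq (x : NParticle H (m + 1))).const_mul
    ((d / 2) ^ 2)) (P.tendsto_sum_norm_tloc_sq _) fun M => ?_
  rw [Finset.mul_sum]
  refine Finset.sum_le_sum fun K _ => ?_
  rw [← mul_pow]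
  refine pow_le_pow_left₀ (by positivity) ?_ 2
  have h1 := P.norm_tloc_le hA hd' (LinearPMap.mem_graph _ x) K
  have h2 : d - 2 * ((m + 1 : ℕ) : ℝ) * (d / (4 * (m + 1))) = d / 2 := by
    push_cast
    field_simp
    ring
  rwa [h2] at h1

theorem nSum_subset_spec_restrictTo_dGamma (hA : IsSelfAdjoint A)
    (hd : ∀ z, DenseRange (subScalar A z)) (m : ℕ) :
    nSum (m + 1) (spec A) ⊆ spec (restrictTo (dGamma A) (m + 1)) := by
  rintro _ ⟨z, hz, rfl⟩
  rw [mem_spec_iff (isClosed_restrictTo_dGamma hA _)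
    (injective_and_denseRange_restrictTo_dGamma hA hd m _).2]
  intro c hc
  -- There are `m + 1` error terms, each at most `c / (m + 2)` times the norm of the tensor; their
  -- sum stays strictly below `c` times that norm.
  have hc' : 0 < c / (m + 2) := by positivity
  choose x hx using fun j => (mem_spec_iff hA.isClosed (hd (z j))).1 (hz j) _ hc'
  obtain ⟨y, hy, hy'⟩ := (LinearPMap.mem_graph_iff _).1 (mem_graph_restrictTo_dGamma hA x)
  dsimp only at hy hy'
  refine ⟨y, ?_⟩
  have hpos : ∀ j, 0 < ‖(x j : H)‖ := by
    intro j
    have h1 := (norm_nonneg _).trans_lt (hx j)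
    exact (pos_iff_pos_of_mul_pos h1).1 hc'
  have hnorm : ‖y‖ = ∏ j, ‖(x j : H)‖ := by
    change ‖(y : NParticle H (m + 1))‖ = _
    rw [hy, norm_tensor]
  have hprod : 0 < ∏ j, ‖(x j : H)‖ := Finset.prod_pos fun j _ => hpos j
  have h1 : subScalar (restrictTo (dGamma A) (m + 1)) (∑ j, z j) y =
      ∑ j, tensor (Function.update (fun i => (x i : H)) j (subScalar A (z j) (x j))) := by
    rw [subScalar_apply, hy', hy, sumApply, Finset.sum_smul, ← Finset.sum_sub_distrib]
    refine Finset.sum_congr rfl fun j _ => ?_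
    simp only [← tensorₘ_apply, subScalar_apply]
    rw [MultilinearMap.map_update_sub, MultilinearMap.map_update_smul, Function.update_eq_self]
  have h2 : ∀ j, ‖tensor (Function.update (fun i => (x i : H)) j (subScalar A (z j) (x j)))‖ ≤
      c / (m + 2) * ∏ i, ‖(x i : H)‖ := by
    intro j
    rw [norm_tensor, ← Finset.mul_prod_erase _ _ (Finset.mem_univ j),
      ← Finset.mul_prod_erase _ (fun i => ‖(x i : H)‖) (Finset.mem_univ j), ← mul_assoc,
      Function.update_self]
    have h3 : ∏ i ∈ Finset.univ.erase j,
        ‖Function.update (fun i => (x i : H)) j (subScalar A (z j) (x j)) i‖ =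
        ∏ i ∈ Finset.univ.erase j, ‖(x i : H)‖ := Finset.prod_congr rfl fun i hi => by
      rw [Function.update_of_ne (Finset.ne_of_mem_erase hi)]
    rw [h3]
    exact mul_le_mul_of_nonneg_right (hx j).le (Finset.prod_nonneg fun _ _ => norm_nonneg _)
  rw [h1, hnorm]
  refine (norm_sum_le _ _).trans_lt ((Finset.sum_le_sum fun j _ => h2 j).trans_lt ?_)
  rw [Finset.sum_const, Finset.card_univ, Fintype.card_fin, nsmul_eq_mul, ← mul_assoc]
  refine mul_lt_mul_of_pos_right ?_ hprod
  push_cast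
  rw [← mul_div_assoc, div_lt_iff₀ (by positivity)]
  linarith

theorem im_eq_zero_of_mem_spec (hA : IsSelfAdjoint A) {z : ℂ} (hz : z ∈ spec A) : z.im = 0 := by
  by_contra h
  exact hz (bijective_subScalar_of_im_ne_zero hA h)

theorem isClosed_nSum_spec (hA : IsSelfAdjoint A) (hd : ∀ z, DenseRange (subScalar A z))
    (h : BddBelow (Complex.re '' spec A) ∨ BddAbove (Complex.re '' spec A)) (n : ℕ) :
    IsClosed (nSum n (spec A)) := by
  have hc := isClosed_spec hA.isClosed hd
  have him : ∀ z ∈ spec A, z.im = 0 := fun z hz => im_eq_zero_of_mem_spec hA hz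
  rcases h with ⟨b, hb⟩ | ⟨b, hb⟩
  · refine isClosed_nSum hc him (s := 1) (by simp) (b := b) (fun z hz => ?_) n
    rw [one_mul]
    exact hb ⟨z, hz, rfl⟩
  · refine isClosed_nSum hc him (s := -1) (by simp) (b := -b) (fun z hz => ?_) n
    rw [neg_one_mul, neg_le_neg_iff]
    exact hb ⟨z, hz, rfl⟩

theorem spec_restrictTo_dGamma (hA : IsSelfAdjoint A) (hd : ∀ z, DenseRange (subScalar A z))
    (m : ℕ) : spec (restrictTo (dGamma A) (m + 1)) = closure (nSum (m + 1) (spec A)) :=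
  (spec_restrictTo_dGamma_subset hA hd m).antisymm
    (closure_minimal (nSum_subset_spec_restrictTo_dGamma hA hd m)
      (isClosed_spec (isClosed_restrictTo_dGamma hA _) fun z =>
        (injective_and_denseRange_restrictTo_dGamma hA hd m z).2))

end SpectrumNParticle

end SecondQuantization

end

theorem proposition3p1 {H : Type*} [NormedAddCommGroup H] [InnerProductSpace ℂ H]
    [CompleteSpace H] (A : H →ₗ.[ℂ] H) (hA : IsSelfAdjoint A) :
    (∀ {ι : Type*} (φ : HilbertBasis ι ℂ H) (lam : ι → ℝ),
      SecondQuantization.HasDiscreteResolution A φ lam →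
      ∀ n : ℕ, ∃ Φ : HilbertBasis (Fin n → ι) ℂ (SecondQuantization.NParticle H n),
        (∀ i : Fin n → ι, Φ i = SecondQuantization.tensor fun j => φ (i j)) ∧
        SecondQuantization.HasDiscreteResolution
          (SecondQuantization.restrictTo (SecondQuantization.dGamma A) n) Φ
          (fun i => ∑ j, lam (i j))) ∧
    (SecondQuantization.spec A = SecondQuantization.specC A →
      ∀ n : ℕ, 1 ≤ n →
        SecondQuantization.spec
            (SecondQuantization.restrictTo (SecondQuantization.dGamma A) n) =
          SecondQuantization.specC
            (SecondQuantization.restrictTo (SecondQuantization.dGamma A) n) ∧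
        SecondQuantization.specC
            (SecondQuantization.restrictTo (SecondQuantization.dGamma A) n) =
          closure (SecondQuantization.nSum n (SecondQuantization.specC A)) ∧
        (BddBelow (Complex.re '' SecondQuantization.specC A) ∨
            BddAbove (Complex.re '' SecondQuantization.specC A) →
          SecondQuantization.specC
              (SecondQuantization.restrictTo (SecondQuantization.dGamma A) n) =
            SecondQuantization.nSum n (SecondQuantization.specC A))) := by
  refine ⟨fun φ lam h n =>
    SecondQuantization.hasDiscreteResolution_restrictTo_dGamma hA φ lam h n, fun hc n hn => ?_⟩
  -- The counting argument singles out one tensor factor, so `n` is written as `m + 1`.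
  obtain ⟨m, rfl⟩ := Nat.exists_eq_add_of_le' hn
  have hd := fun z => (SecondQuantization.injective_and_denseRange_of_spec_eq_specC hc z).2
  have h1 := SecondQuantization.spec_eq_specC
    (SecondQuantization.injective_and_denseRange_restrictTo_dGamma hA hd m)
  rw [← h1, ← hc, SecondQuantization.spec_restrictTo_dGamma hA hd]
  exact ⟨rfl, rfl, fun hb => (SecondQuantization.isClosed_nSum_spec hA hd hb _).closure_eq⟩
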